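/- Work either in the real smooth category ($\Bbbk=\mathbb{R}$, smooth $=C^\infty$) or in the complex holomorphic category ($\Bbbk=\mathbb{C}$, smooth $=$ holomorphic). All manifolds and Lie groups are finite-dimensional, and $M$ is a Hausdorff manifold. Write $\mathfrak{X}(M)$ for the Lie algebra of smooth vector fields on $M$, and $\mathfrak{g}=T_1G$ for the Lie algebra of a Lie group $G$ (with the bracket of left-invariant vector fields). **Definitions.** Let $G$ be a connected Lie group. A *local $G$-action* on $M$ is a smooth map $\Phi:\Omega\to M$, where $\Omega\subset G\times M$ is a connected open set containing $\{1\}\times M$, such that $\Phi(1,p)=p$ for all $p\in M$, and $\Phi(g_1g_2,p)=\Phi(g_1,\Phi(g_2,p))$ for all $g_1,g_2\in G$, $p\in M$ for which both sides are defined. It is *global* (an action of $G$) if $\Omega=G\times M$. For $p\in M$ let $V_p=\{g\in G:(g,p)\in\Omega\}$. The local action is *maximal* if for every $p\in M$ and every sequence $(g_i)$ in $V_p$ converging to a point of the boundary of $V_p$ in $G$, the sequence $\Phi(g_i,p)$ leaves every compact subset of $M$ (i.e. for each compact $C\subset M$, $\Phi(g_i,p)\notin C$ for all large $i$). A representation $\rho:\mathfrak{g}\to\mathfrak{X}(M)$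 is a $\Bbbk$-linear map with $\rho([X,Y])=[\rho(X),\rho(Y)]$. The representation $\rho$ *integrates to* the local action $\Phi$ if $\rho(X)(p)=\frac{d}{dt}\big|_{t=0}\Phi(\exp(-tX),p)$ for all $X\in\mathfrak{g}$, $p\in M$. It is *univalent* if it integrates to some maximal local $G$-action. **Theorem B.** Let $G=H\ltimes K$ be a Lie group which is the semidirect product of Lie groups $H$ and $K$, with $G,H,K$ connected: $H$ and $K$ are identified with Lie subgroups of $G$, $K$ is normal in $G$, and $(k,h)\mapsto kh$ is a diffeomorphism $K\times H\to G$. Let $\mathfrak{g}=\mathfrak{h}\ltimes\mathfrak{k}$ be the corresponding decomposition of Lie algebras, and let $\rho:\mathfrak{g}\to\mathfrak{X}(M)$ be a representation. Assume that 1. $\rho|_{\mathfrak{h}}$ integrates to a (global) action of $H$ on $M$; 2. $\rho|_{\mathfrak{k}}$ integrates to a maximal local action of $K$ on $M$ (i.e. it is univalent). Then $\rho$ integrates to a maximal local action of $G$ on $M$ (i.e. it is univalent). -/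

import Mathlib

open Set Filter Topology
open scoped Manifold ContDiff

noncomputable section

/-- The space `𝔛(M)` of vector fields of class `C^∞` over `𝕜` on a manifold `M` modelled on `E`:
the smooth vector fields if `𝕜 = ℝ`, the holomorphic vector fields if `𝕜 = ℂ`. -/
abbrev SmoothVectorField (𝕜 : Type*) [RCLike 𝕜] (E : Type*) [NormedAddCommGroup E]
    [NormedSpace 𝕜 E] (M : Type*) [TopologicalSpace M] [ChartedSpace E M]
    [IsManifold 𝓘(𝕜, E) ∞ M] :=
  ContMDiffSection 𝓘(𝕜, E) E ∞ (TangentSpace 𝓘(𝕜, E) : M → Type _)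

/-- The Lie algebra `T₁G` of the Lie group `G`, with the bracket of left-invariant vector fields. -/
abbrev LieAlg (𝕜 : Type*) [RCLike 𝕜] (E : Type*) [NormedAddCommGroup E] [NormedSpace 𝕜 E]
    (G : Type*) [TopologicalSpace G] [ChartedSpace E G] [Group G] :=
  GroupLieAlgebra 𝓘(𝕜, E) G

/-- The linear map `ρ` from the Lie algebra of `G` to the vector fields on `M` is a representation:
it sends Lie brackets to Lie brackets of vector fields. -/
def IsVectorFieldRepresentation {𝕜 : Type*} [RCLike 𝕜]
    {E : Type*} [NormedAddCommGroup E] [NormedSpace 𝕜 E]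
    {G : Type*} [TopologicalSpace G] [ChartedSpace E G] [Group G]
    {F : Type*} [NormedAddCommGroup F] [NormedSpace 𝕜 F]
    {M : Type*} [TopologicalSpace M] [ChartedSpace F M] [IsManifold 𝓘(𝕜, F) ∞ M]
    (ρ : LieAlg 𝕜 E G →ₗ[𝕜] SmoothVectorField 𝕜 F M) : Prop :=
  ∀ (X Y : LieAlg 𝕜 E G) (p : M),
    ρ ⁅X, Y⁆ p = VectorField.mlieBracket 𝓘(𝕜, F) (fun q => ρ X q) (fun q => ρ Y q) p

/-- A local `G`-transformation group `Φ : Ω ⊆ G × M → M` acting on `M`. (The values of `Φ` outside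
of `Ω` are irrelevant.) -/
structure IsLocalAction (𝕜 : Type*) [RCLike 𝕜]
    (E : Type*) [NormedAddCommGroup E] [NormedSpace 𝕜 E]
    {G : Type*} [TopologicalSpace G] [ChartedSpace E G] [Group G]
    (F : Type*) [NormedAddCommGroup F] [NormedSpace 𝕜 F]
    {M : Type*} [TopologicalSpace M] [ChartedSpace F M]
    (Ω : Set (G × M)) (Φ : G × M → M) : Prop where
  isOpen : IsOpen Ω
  isConnected : IsConnected Ω
  one_mem : ∀ p : M, ((1 : G), p) ∈ Ω
  contMDiffOn : ContMDiffOn (𝓘(𝕜, E).prod 𝓘(𝕜, F)) 𝓘(𝕜, F) ∞ Φ Ω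
  one_act : ∀ p : M, Φ (1, p) = p
  mul_act : ∀ (g₁ g₂ : G) (p : M), (g₁ * g₂, p) ∈ Ω → (g₂, p) ∈ Ω → (g₁, Φ (g₂, p)) ∈ Ω →
    Φ (g₁ * g₂, p) = Φ (g₁, Φ (g₂, p))

/-- A local action `Φ : Ω ⊆ G × M → M` is maximal if for every `p`, along every sequence `gᵢ` in
`V_p = {g | (g, p) ∈ Ω}` that converges to a boundary point of `V_p` in `G`, the sequence
`Φ (gᵢ, p)` leaves every compact subset of `M`. -/
structure IsMaximalLocalAction (𝕜 : Type*) [RCLike 𝕜]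
    (E : Type*) [NormedAddCommGroup E] [NormedSpace 𝕜 E]
    {G : Type*} [TopologicalSpace G] [ChartedSpace E G] [Group G]
    (F : Type*) [NormedAddCommGroup F] [NormedSpace 𝕜 F]
    {M : Type*} [TopologicalSpace M] [ChartedSpace F M]
    (Ω : Set (G × M)) (Φ : G × M → M) : Prop extends IsLocalAction 𝕜 E F Ω Φ where
  leaves_compacts : ∀ (p : M) (g : ℕ → G) (g' : G), (∀ i, (g i, p) ∈ Ω) →
    Tendsto g atTop (𝓝 g') → g' ∈ frontier {a : G | (a, p) ∈ Ω} →
    ∀ C : Set M, IsCompact C → ∀ᶠ i in atTop, Φ (g i, p) ∉ C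

/-- The local action `Φ` integrates `ρ`: for every `X` in the Lie algebra of `G` and every `p`, the
vector `ρ X p` is the derivative of `t ↦ Φ (exp (-tX), p)` at `t = 0`, that is, the image of `-X`
under the derivative at `1` of the orbit map `g ↦ Φ (g, p)`.
(The sign is the usual one that turns the infinitesimal generator of a left action into a
homomorphism for the bracket of left-invariant vector fields. Recall that `Φ (1, p) = p`.) -/
def Integrates {𝕜 : Type*} [RCLike 𝕜]
    {E : Type*} [NormedAddCommGroup E] [NormedSpace 𝕜 E]
    {G : Type*} [TopologicalSpace G] [ChartedSpace E G] [Group G]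
    {F : Type*} [NormedAddCommGroup F] [NormedSpace 𝕜 F]
    {M : Type*} [TopologicalSpace M] [ChartedSpace F M] [IsManifold 𝓘(𝕜, F) ∞ M]
    (Φ : G × M → M) (ρ : LieAlg 𝕜 E G →ₗ[𝕜] SmoothVectorField 𝕜 F M) : Prop :=
  ∀ (X : LieAlg 𝕜 E G) (p : M),
    ρ X p = mfderiv 𝓘(𝕜, E) 𝓘(𝕜, F) (fun g : G => Φ (g, p)) 1 (-X)

/-- `ρ` integrates to a (global) action of `G`, that is, one with `Ω = G × M`. -/
def IntegratesToGlobalAction {𝕜 : Type*} [RCLike 𝕜]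
    {E : Type*} [NormedAddCommGroup E] [NormedSpace 𝕜 E]
    {G : Type*} [TopologicalSpace G] [ChartedSpace E G] [Group G]
    {F : Type*} [NormedAddCommGroup F] [NormedSpace 𝕜 F]
    {M : Type*} [TopologicalSpace M] [ChartedSpace F M] [IsManifold 𝓘(𝕜, F) ∞ M]
    (ρ : LieAlg 𝕜 E G →ₗ[𝕜] SmoothVectorField 𝕜 F M) : Prop :=
  ∃ Ψ : G × M → M, IsLocalAction 𝕜 E F univ Ψ ∧ Integrates Ψ ρ

/-- `ρ` is univalent: it integrates to a maximal local action of `G`. -/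
def IsUnivalent {𝕜 : Type*} [RCLike 𝕜]
    {E : Type*} [NormedAddCommGroup E] [NormedSpace 𝕜 E]
    {G : Type*} [TopologicalSpace G] [ChartedSpace E G] [Group G]
    {F : Type*} [NormedAddCommGroup F] [NormedSpace 𝕜 F]
    {M : Type*} [TopologicalSpace M] [ChartedSpace F M] [IsManifold 𝓘(𝕜, F) ∞ M]
    (ρ : LieAlg 𝕜 E G →ₗ[𝕜] SmoothVectorField 𝕜 F M) : Prop :=
  ∃ (Ω : Set (G × M)) (Φ : G × M → M), IsMaximalLocalAction 𝕜 E F Ω Φ ∧ Integrates Φ ρ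

/-- The Lie group `G` is the semidirect product `H ⋉ K` of `H` and `K`, which are identified with
subgroups of `G` by means of the homomorphisms `j : H → G` and `i : K → G`: the subgroup `K` is
normal, and `(k, h) ↦ k h` is a diffeomorphism `K × H ≃ G`. -/
structure IsSemidirectProduct (𝕜 : Type*) [RCLike 𝕜]
    (EG : Type*) [NormedAddCommGroup EG] [NormedSpace 𝕜 EG]
    (EH : Type*) [NormedAddCommGroup EH] [NormedSpace 𝕜 EH]
    (EK : Type*) [NormedAddCommGroup EK] [NormedSpace 𝕜 EK]
    {G : Type*} [TopologicalSpace G] [ChartedSpace EG G] [Group G]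
    {H : Type*} [TopologicalSpace H] [ChartedSpace EH H] [Group H]
    {K : Type*} [TopologicalSpace K] [ChartedSpace EK K] [Group K]
    (j : H →* G) (i : K →* G) : Prop where
  contMDiff_left : ContMDiff 𝓘(𝕜, EH) 𝓘(𝕜, EG) ∞ j
  contMDiff_right : ContMDiff 𝓘(𝕜, EK) 𝓘(𝕜, EG) ∞ i
  normal : i.range.Normal
  exists_diffeomorph :
    ∃ e : Diffeomorph (𝓘(𝕜, EK).prod 𝓘(𝕜, EH)) 𝓘(𝕜, EG) (K × H) G ∞,
      ∀ x : K × H, e x = i x.1 * j x.2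

/-- The linear map `T₁H → T₁G` induced by a homomorphism `f : H → G` of Lie groups, namely the
derivative of `f` at `1` (recall that `f 1 = 1`). -/
def lieAlgMap (𝕜 : Type*) [RCLike 𝕜]
    {E : Type*} [NormedAddCommGroup E] [NormedSpace 𝕜 E]
    {E' : Type*} [NormedAddCommGroup E'] [NormedSpace 𝕜 E']
    {H : Type*} [TopologicalSpace H] [ChartedSpace E H] [Group H]
    {G : Type*} [TopologicalSpace G] [ChartedSpace E' G] [Group G]
    (f : H →* G) : LieAlg 𝕜 E H →ₗ[𝕜] LieAlg 𝕜 E' G :=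
  (mfderiv 𝓘(𝕜, E) 𝓘(𝕜, E') f 1 : E →L[𝕜] E').toLinearMap

end

/-! Every `g` in `G` is uniquely `h k` with `h` in `H`, `k` in `K`, and the action of `G` has to be
`(h k, p) ↦ Ψ (h, Φ (k, p))`. As `Ψ` is global, its domain is governed by `k` alone. The composition
law comes down to the equivariance `Ψ (h, Φ (k, q)) = Φ (h k h⁻¹, Ψ (h, q))`, domains included.

Infinitesimally, equivariance says that `Ψ (h, ·)` carries `ρ X` to `ρ (Ad h X)`
(`mfderiv_act_apply_eq_adjointMap`). The pullback of `ρ (Ad u X)` by `Ψ (u, ·)` has derivative zero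
at `u = 1`: the Lie derivative of `ρ X` and the derivative of `Ad` contribute opposite brackets,
because `ρ` is a representation. A cocycle identity moves this to every `u`, and `H` is connected.

Equivariance then holds for `k` near `1` (`IsLocalAction.eventually_equivariant`), and it propagates
along the slice of the domain over `q` (`IsMaximalLocalAction.equivariant`). Maximality keeps the
image point in the domain. The slices have to be connected, so the domain is first cut down to the
components of `1`, which preserves maximality.

Flows and the exponential map are avoided: each integration is the remark that a map with zero
derivative is locally constant. This treats the real and the complex case alike. -/

/-! ### Lie derivative of a vector field along a family of transformations -/

/-- The spatial derivative of `Ψ (s, ·)` at `x₀` is the identity for `s = s₀`, so differentiating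
its inverse only changes the sign. The product rule gives `DY (V) - DV (Y)` for the generator `V`,
once symmetry of the second derivative exchanges the parameter and space directions. -/
theorem hasFDerivAt_inverse_fderiv_apply {𝕜 : Type*} [RCLike 𝕜]
    {P : Type*} [NormedAddCommGroup P] [NormedSpace 𝕜 P]
    {F : Type*} [NormedAddCommGroup F] [NormedSpace 𝕜 F] [CompleteSpace F]
    {Ψ : P × F → F} {s₀ : P} {x₀ : F} (hΨ : ContDiffAt 𝕜 2 Ψ (s₀, x₀))
    (h0 : ∀ᶠ x in 𝓝 x₀, Ψ (s₀, x) = x) {Y : F → F} (hY : DifferentiableAt 𝕜 Y x₀) :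
    ∃ L : P →L[𝕜] F,
      HasFDerivAt (fun s => (fderiv 𝕜 (fun x => Ψ (s, x)) x₀).inverse (Y (Ψ (s, x₀)))) L s₀ ∧
      ∀ z, L z =
        VectorField.lieBracket 𝕜 (fun x => fderiv 𝕜 (fun s => Ψ (s, x)) s₀ z) Y x₀ := by
  set D := fderiv 𝕜 Ψ with hDdef
  have hDd : DifferentiableAt 𝕜 D (s₀, x₀) :=
    (hΨ.fderiv_right (m := 1) (by norm_num)).differentiableAt (by norm_num)
  set D2 := fderiv 𝕜 D (s₀, x₀) with hD2
  have hsymm : IsSymmSndFDerivAt 𝕜 Ψ (s₀, x₀) := hΨ.isSymmSndFDerivAt (by simp)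
  have hdiff : ∀ᶠ y in 𝓝 (s₀, x₀), DifferentiableAt 𝕜 Ψ y := by
    filter_upwards [hΨ.eventually (by simp)] with y hy
    exact hy.differentiableAt (by norm_num)
  have cl : Tendsto (fun s : P => (s, x₀)) (𝓝 s₀) (𝓝 (s₀, x₀)) :=
    (Continuous.prodMk_left x₀).tendsto s₀
  have cr : Tendsto (fun x : F => (s₀, x)) (𝓝 x₀) (𝓝 (s₀, x₀)) :=
    (Continuous.prodMk_right s₀).tendsto x₀
  have hl : HasFDerivAt (fun s : P => (s, x₀)) (ContinuousLinearMap.inl 𝕜 P F) s₀ :=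
    hasFDerivAt_prodMk_left s₀ x₀
  have hr : ∀ s, HasFDerivAt (fun x : F => (s, x)) (ContinuousLinearMap.inr 𝕜 P F) x₀ :=
    fun s => hasFDerivAt_prodMk_right s x₀
  have hA : (fun s => fderiv 𝕜 (fun x => Ψ (s, x)) x₀) =ᶠ[𝓝 s₀]
      fun s => (D (s, x₀)).comp (ContinuousLinearMap.inr 𝕜 P F) := by
    filter_upwards [cl.eventually hdiff] with s hs
    exact (hs.hasFDerivAt.comp x₀ (hr s)).fderiv
  have hA' : HasFDerivAt (fun s => fderiv 𝕜 (fun x => Ψ (s, x)) x₀)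
      (((ContinuousLinearMap.compL 𝕜 F (P × F) F).flip (ContinuousLinearMap.inr 𝕜 P F)).comp
        (D2.comp (ContinuousLinearMap.inl 𝕜 P F))) s₀ := by
    refine HasFDerivAt.congr_of_eventuallyEq ?_ hA
    exact ((ContinuousLinearMap.compL 𝕜 F (P × F) F).flip
      (ContinuousLinearMap.inr 𝕜 P F)).hasFDerivAt.comp s₀ (hDd.hasFDerivAt.comp s₀ hl)
  have hA0 : fderiv 𝕜 (fun x => Ψ (s₀, x)) x₀ = ContinuousLinearMap.id 𝕜 F := by
    have : (fun x => Ψ (s₀, x)) =ᶠ[𝓝 x₀] id := h0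
    rw [this.fderiv_eq, fderiv_id]
  have hx0 : Ψ (s₀, x₀) = x₀ := h0.self_of_nhds
  have hinv : HasFDerivAt (fun s => (fderiv 𝕜 (fun x => Ψ (s, x)) x₀).inverse)
      (-(((ContinuousLinearMap.compL 𝕜 F (P × F) F).flip (ContinuousLinearMap.inr 𝕜 P F)).comp
        (D2.comp (ContinuousLinearMap.inl 𝕜 P F)))) s₀ := by
    have h1 : HasFDerivAt (Ring.inverse : (F →L[𝕜] F) → (F →L[𝕜] F))
        (-ContinuousLinearMap.mulLeftRight 𝕜 (F →L[𝕜] F) ↑(1 : (F →L[𝕜] F)ˣ)⁻¹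
          ↑(1 : (F →L[𝕜] F)ˣ)⁻¹)
        (fderiv 𝕜 (fun x => Ψ (s₀, x)) x₀) := by
      have := hasFDerivAt_ringInverse (𝕜 := 𝕜) (1 : (F →L[𝕜] F)ˣ)
      rw [hA0]
      exact this
    have h2 := h1.comp s₀ hA'
    simp only [ContinuousLinearMap.ringInverse_eq_inverse] at h2
    convert! h2 using 1
  have hYc : HasFDerivAt (fun s => Y (Ψ (s, x₀)))
      ((fderiv 𝕜 Y x₀).comp ((D (s₀, x₀)).comp (ContinuousLinearMap.inl 𝕜 P F))) s₀ := by
    have h1 : HasFDerivAt (fun s => Ψ (s, x₀))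
        ((D (s₀, x₀)).comp (ContinuousLinearMap.inl 𝕜 P F)) s₀ :=
      hdiff.self_of_nhds.hasFDerivAt.comp s₀ hl
    refine HasFDerivAt.comp s₀ ?_ h1
    rw [hx0]
    exact hY.hasFDerivAt
  refine ⟨_, hinv.clm_apply hYc, fun z => ?_⟩
  have hV : (fun x => fderiv 𝕜 (fun s => Ψ (s, x)) s₀ z) =ᶠ[𝓝 x₀] fun x => D (s₀, x) (z, 0) := by
    filter_upwards [cr.eventually hdiff] with x hx
    have := (hx.hasFDerivAt.comp s₀ (hasFDerivAt_prodMk_left (𝕜 := 𝕜) s₀ x)).fderiv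
    simp only [Function.comp_def] at this
    rw [this]
    rfl
  have hV' : HasFDerivAt (fun x => fderiv 𝕜 (fun s => Ψ (s, x)) s₀ z)
      ((ContinuousLinearMap.apply 𝕜 F (z, (0 : F))).comp
        (D2.comp (ContinuousLinearMap.inr 𝕜 P F))) x₀ := by
    refine HasFDerivAt.congr_of_eventuallyEq ?_ hV
    exact (ContinuousLinearMap.apply 𝕜 F (z, (0 : F))).hasFDerivAt.comp x₀
      (hDd.hasFDerivAt.comp x₀ (hr s₀))
  have hV0 : fderiv 𝕜 (fun s => Ψ (s, x₀)) s₀ z = D (s₀, x₀) (z, 0) := hV.self_of_nhds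
  rw [VectorField.lieBracket, hV'.fderiv, hV0, hx0, hA0]
  have := hsymm.eq (z, 0) (0, Y x₀)
  simp only [← hDdef, ← hD2] at this
  simp [this, sub_eq_add_neg]

theorem two_le_infty : (2 : WithTop ℕ∞) ≤ ∞ := WithTop.coe_le_coe.2 le_top

section
variable {𝕜 : Type*} [RCLike 𝕜]
  {P : Type*} [NormedAddCommGroup P] [NormedSpace 𝕜 P]
  {F : Type*} [NormedAddCommGroup F] [NormedSpace 𝕜 F]
  {N : Type*} [TopologicalSpace N] [ChartedSpace P N]
  {M : Type*} [TopologicalSpace M] [ChartedSpace F M]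

/-- The vector field `p ↦ ∂Ψ(u, p)/∂u` at `u = e` in the direction `z`, for a family `Ψ` of
transformations of `M` with `Ψ (e, p) = p`. -/
noncomputable def generatorField (𝕜 : Type*) [RCLike 𝕜]
    {P : Type*} [NormedAddCommGroup P] [NormedSpace 𝕜 P]
    {F : Type*} [NormedAddCommGroup F] [NormedSpace 𝕜 F]
    {N : Type*} [TopologicalSpace N] [ChartedSpace P N]
    {M : Type*} [TopologicalSpace M] [ChartedSpace F M] (Ψ : N × M → M) (e : N) (z : P) (p : M) :
    TangentSpace 𝓘(𝕜, F) p :=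
  (mfderiv 𝓘(𝕜, P) 𝓘(𝕜, F) (fun u => Ψ (u, p)) e : P →L[𝕜] F) z

/-- The value at `q` of the pullback of `Y` by the transformation `Ψ (u, ·)`, as a function
of `u`. -/
noncomputable def pullbackFamily (𝕜 : Type*) [RCLike 𝕜]
    {F : Type*} [NormedAddCommGroup F] [NormedSpace 𝕜 F]
    {N : Type*}
    {M : Type*} [TopologicalSpace M] [ChartedSpace F M] (Ψ : N × M → M)
    (Y : ∀ p : M, TangentSpace 𝓘(𝕜, F) p) (q : M) (u : N) : F :=
  (VectorField.mpullback 𝓘(𝕜, F) 𝓘(𝕜, F) (fun p => Ψ (u, p)) Y q : F)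

/-- This form of the chain rule types derivatives between model spaces and takes the base point
equality as a hypothesis, so that no tangent space needs transporting along an equality of points.
-/
theorem HasMFDerivAt.comp_of_eq_flat {𝕜 : Type*} [NontriviallyNormedField 𝕜]
    {E : Type*} [NormedAddCommGroup E] [NormedSpace 𝕜 E] {B : Type*} [TopologicalSpace B]
    {I : ModelWithCorners 𝕜 E B} {X : Type*} [TopologicalSpace X] [ChartedSpace B X]
    {E' : Type*} [NormedAddCommGroup E'] [NormedSpace 𝕜 E'] {B' : Type*} [TopologicalSpace B']
    {I' : ModelWithCorners 𝕜 E' B'} {X' : Type*} [TopologicalSpace X'] [ChartedSpace B' X']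
    {E'' : Type*} [NormedAddCommGroup E''] [NormedSpace 𝕜 E''] {B'' : Type*}
    [TopologicalSpace B''] {I'' : ModelWithCorners 𝕜 E'' B''} {X'' : Type*}
    [TopologicalSpace X''] [ChartedSpace B'' X'']
    {g : X' → X''} {f : X → X'} {x : X} {y : X'} {g' : E' →L[𝕜] E''} {f' : E →L[𝕜] E'}
    (hg : HasMFDerivAt I' I'' g y g') (hf : HasMFDerivAt I I' f x f') (h : f x = y) :
    HasMFDerivAt I I'' (fun x => g (f x)) x (g'.comp f' : E →L[𝕜] E'') := by
  subst h
  exact hg.comp x hf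

theorem hasMFDerivAt_extChartAt_self [IsManifold 𝓘(𝕜, F) 1 M] (q : M) :
    HasMFDerivAt 𝓘(𝕜, F) 𝓘(𝕜, F) (extChartAt 𝓘(𝕜, F) q) q (ContinuousLinearMap.id 𝕜 F) := by
  have := (mdifferentiableAt_extChartAt (I := 𝓘(𝕜, F)) (mem_chart_source F q)).hasMFDerivAt
  rwa [mfderiv_extChartAt_self] at this

theorem hasMFDerivAt_extChartAt_symm_self [IsManifold 𝓘(𝕜, F) 1 M] (q : M) :
    HasMFDerivAt 𝓘(𝕜, F) 𝓘(𝕜, F) (extChartAt 𝓘(𝕜, F) q).symm (extChartAt 𝓘(𝕜, F) q q)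
      (ContinuousLinearMap.id 𝕜 F) := by
  have := (mdifferentiableWithinAt_extChartAt_symm (I := 𝓘(𝕜, F))
    (mem_extChartAt_target q)).hasMFDerivWithinAt
  rw [mfderivWithin_range_extChartAt_symm] at this
  exact hasMFDerivWithinAt_univ.1 (by rwa [modelWithCornersSelf_coe, range_id] at this)

/-- The vector space case is applied in the charts at `e` and `q`. The derivative of a chart at its
own base point is the identity, so neither the derivative nor the bracket changes. -/
theorem hasMFDerivAt_pullbackFamily [CompleteSpace F]
    [IsManifold 𝓘(𝕜, P) ∞ N] [IsManifold 𝓘(𝕜, F) ∞ M]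
    {Ψ : N × M → M} {e : N} {q : M}
    (hΨ : ContMDiffAt (𝓘(𝕜, P).prod 𝓘(𝕜, F)) 𝓘(𝕜, F) ∞ Ψ (e, q))
    (h0 : ∀ p, Ψ (e, p) = p) {Y : ∀ p : M, TangentSpace 𝓘(𝕜, F) p}
    (hY : MDifferentiableAt 𝓘(𝕜, F) (𝓘(𝕜, F).prod 𝓘(𝕜, F))
      (fun p => (Y p : TangentBundle 𝓘(𝕜, F) M)) q) :
    ∃ L : P →L[𝕜] F,
      HasMFDerivAt 𝓘(𝕜, P) 𝓘(𝕜, F) (pullbackFamily 𝕜 Ψ Y q) e L ∧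
      ∀ z : P, L z = VectorField.mlieBracket 𝓘(𝕜, F) (generatorField 𝕜 Ψ e z) Y q := by
  have : IsManifold 𝓘(𝕜, P) 1 N := .of_le (n := ∞) (by simp)
  have : IsManifold 𝓘(𝕜, F) 1 M := .of_le (n := ∞) (by simp)
  have : IsManifold 𝓘(𝕜, F) 2 M := .of_le (n := ∞) two_le_infty
  set κ := extChartAt 𝓘(𝕜, P) e with hκ
  set φ := extChartAt 𝓘(𝕜, F) q with hφ
  set Y' : F → F := VectorField.mpullbackWithin 𝓘(𝕜, F) 𝓘(𝕜, F) φ.symm Y (range 𝓘(𝕜, F)) with hY'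
  set Ψ' : P × F → F := fun y => φ (Ψ (κ.symm y.1, φ.symm y.2)) with hΨ'
  have hκe : κ.symm (κ e) = e := extChartAt_to_inv e
  have hφq : φ.symm (φ q) = q := extChartAt_to_inv q
  have hY'd : DifferentiableAt 𝕜 Y' (φ q) := by
    have := MDifferentiableWithinAt.differentiableWithinAt_mpullbackWithin_vectorField
      (I := 𝓘(𝕜, F)) (s := univ) (x := q) hY.mdifferentiableWithinAt
    rw [preimage_univ, univ_inter, modelWithCornersSelf_coe, range_id] at this
    rw [hY', modelWithCornersSelf_coe, range_id]
    exact differentiableWithinAt_univ.1 this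
  have hκs : ContMDiffAt 𝓘(𝕜, P) 𝓘(𝕜, P) ∞ κ.symm (κ e) :=
    (contMDiffOn_extChartAt_symm e).contMDiffAt (extChartAt_target_mem_nhds e)
  have hφs : ∀ x ∈ φ.target, ContMDiffAt 𝓘(𝕜, F) 𝓘(𝕜, F) ∞ φ.symm x := fun x hx =>
    (contMDiffOn_extChartAt_symm q).contMDiffAt ((isOpen_extChartAt_target q).mem_nhds hx)
  have hΨ'c : ContDiffAt 𝕜 ∞ Ψ' (κ e, φ q) := by
    rw [← contMDiffAt_iff_contDiffAt]
    have h1 : ContMDiffAt 𝓘(𝕜, P × F) (𝓘(𝕜, P).prod 𝓘(𝕜, F)) ∞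
        (fun y : P × F => (κ.symm y.1, φ.symm y.2)) (κ e, φ q) :=
      (hκs.comp (κ e, φ q) contDiffAt_fst.contMDiffAt).prodMk
        ((hφs _ (mem_extChartAt_target q)).comp (κ e, φ q) contDiffAt_snd.contMDiffAt)
    have h2 : ContMDiffAt (𝓘(𝕜, P).prod 𝓘(𝕜, F)) 𝓘(𝕜, F) ∞ Ψ (κ.symm (κ e), φ.symm (φ q)) := by
      rw [hκe, hφq]; exact hΨ
    have h3 : ContMDiffAt 𝓘(𝕜, F) 𝓘(𝕜, F) ∞ φ (Ψ (κ.symm (κ e), φ.symm (φ q))) := by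
      rw [hκe, hφq, h0]; exact contMDiffAt_extChartAt
    exact h3.comp (κ e, φ q) (h2.comp (κ e, φ q) h1)
  have hφ0 : ∀ᶠ x in 𝓝 (φ q), x ∈ φ.target := extChartAt_target_mem_nhds q
  have h0' : ∀ᶠ x in 𝓝 (φ q), Ψ' (κ e, x) = x := by
    filter_upwards [hφ0] with x hx
    simp only [hΨ', hκe, h0]
    exact φ.right_inv hx
  obtain ⟨L, hL, hLz⟩ := hasFDerivAt_inverse_fderiv_apply (hΨ'c.of_le two_le_infty)
    h0' hY'd
  have hdiff : ∀ᶠ y in 𝓝 (e, q), MDifferentiableAt (𝓘(𝕜, P).prod 𝓘(𝕜, F)) 𝓘(𝕜, F) Ψ y := by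
    have := (contMDiffAt_iff_contMDiffAt_nhds (by simp)).1 (hΨ.of_le (m := 1) (by simp))
    filter_upwards [this] with y hy
    exact hy.mdifferentiableAt (by simp)
  refine ⟨L, ?_, fun z => ?_⟩
  · have h1 := (hasMFDerivAt_iff_hasFDerivAt.2 hL).comp e (hasMFDerivAt_extChartAt_self e)
    refine HasMFDerivAt.congr_of_eventuallyEq (by simpa using! h1) ?_
    have cl : Tendsto (fun s : N => (s, q)) (𝓝 e) (𝓝 (e, q)) :=
      (Continuous.prodMk_left q).tendsto e
    have ct : Tendsto (fun s : N => Ψ (s, q)) (𝓝 e) (𝓝 q) := by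
      have := hΨ.continuousAt.tendsto.comp cl
      rwa [h0] at this
    have hYe := VectorField.eventuallyEq_mpullback_mpullbackWithin_extChartAt
      (I := 𝓘(𝕜, F)) (s := univ) (x := q) Y
    rw [nhdsWithin_univ] at hYe
    filter_upwards [cl.eventually hdiff, extChartAt_source_mem_nhds (I := 𝓘(𝕜, P)) e,
      ct.eventually hYe, ct.eventually (extChartAt_source_mem_nhds (I := 𝓘(𝕜, F)) q)]
      with u hu hus huY huq
    have hku : κ.symm (κ u) = u := κ.left_inv hus
    set A : F →L[𝕜] F := mfderiv 𝓘(𝕜, F) 𝓘(𝕜, F) (fun p => Ψ (u, p)) q with hA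
    set B : F →L[𝕜] F := mfderiv 𝓘(𝕜, F) 𝓘(𝕜, F) φ (Ψ (u, q)) with hBdef
    have hd : HasMFDerivAt 𝓘(𝕜, F) 𝓘(𝕜, F) (fun p => Ψ (u, p)) q A :=
      (hu.comp q (mdifferentiableAt_const.prodMk mdifferentiableAt_id)).hasMFDerivAt
    have hB : HasMFDerivAt 𝓘(𝕜, F) 𝓘(𝕜, F) φ (Ψ (u, q)) B :=
      (mdifferentiableAt_extChartAt (I := 𝓘(𝕜, F))
      (by rwa [extChartAt_source] at huq : Ψ (u, q) ∈ (chartAt F q).source)).hasMFDerivAt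
    have hc := (hB.comp_of_eq_flat hd rfl).comp_of_eq_flat
      (hasMFDerivAt_extChartAt_symm_self q) hφq
    have hf : fderiv 𝕜 (fun x => Ψ' (κ u, x)) (φ q) = B.comp A := by
      simp only [hΨ', hku]
      exact HasFDerivAt.fderiv (𝕜 := 𝕜) (hasMFDerivAt_iff_hasFDerivAt.1 hc)
    have hBi : B.IsInvertible := isInvertible_mfderiv_extChartAt huq
    have hYB : Y (Ψ (u, q)) = B.inverse (Y' (φ (Ψ (u, q)))) := huY
    -- Both sides are `A.inverse` applied to `B.inverse (Y' _)`. Only `B` has to be invertible: if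
    -- `A` is not, the same default inverse appears on both sides.
    have hgoal : A.inverse (Y (Ψ (u, q))) =
        (fderiv 𝕜 (fun x => Ψ' (κ u, x)) (φ q)).inverse (Y' (Ψ' (κ u, φ q))) := by
      rw [hf, hBi.inverse_comp_apply_of_left, hYB]
      simp only [hΨ', hku, hφq]
    exact hgoal
  · rw [hLz]
    set V : ∀ p : M, TangentSpace 𝓘(𝕜, F) p := generatorField 𝕜 Ψ e z with hV
    set V' : F → F := VectorField.mpullbackWithin 𝓘(𝕜, F) 𝓘(𝕜, F) φ.symm V (range 𝓘(𝕜, F))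
      with hV'
    have hVe : (fun x => fderiv 𝕜 (fun s => Ψ' (s, x)) (κ e) z) =ᶠ[𝓝 (φ q)] V' := by
      have ct : Tendsto (fun x => (e, φ.symm x)) (𝓝 (φ q)) (𝓝 (e, q)) := by
        refine Tendsto.prodMk_nhds tendsto_const_nhds ?_
        have := (continuousAt_extChartAt_symm (I := 𝓘(𝕜, F)) q).tendsto
        rwa [extChartAt_to_inv] at this
      filter_upwards [ct.eventually hdiff, hφ0] with x hx hxt
      set A : P →L[𝕜] F := mfderiv 𝓘(𝕜, P) 𝓘(𝕜, F) (fun u => Ψ (u, φ.symm x)) e with hA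
      set B : F →L[𝕜] F := mfderiv 𝓘(𝕜, F) 𝓘(𝕜, F) φ (φ.symm x) with hBdef
      set C : F →L[𝕜] F := mfderivWithin 𝓘(𝕜, F) 𝓘(𝕜, F) φ.symm (range 𝓘(𝕜, F)) x with hCdef
      have hd : HasMFDerivAt 𝓘(𝕜, P) 𝓘(𝕜, F) (fun u => Ψ (u, φ.symm x)) e A :=
        (hx.comp e (mdifferentiableAt_id.prodMk mdifferentiableAt_const)).hasMFDerivAt
      have hB : HasMFDerivAt 𝓘(𝕜, F) 𝓘(𝕜, F) φ (φ.symm x) B :=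
        (mdifferentiableAt_extChartAt (I := 𝓘(𝕜, F)) (by
          have := φ.map_target hxt
          rwa [extChartAt_source] at this)).hasMFDerivAt
      have hc := (hB.comp_of_eq_flat hd (h0 _)).comp_of_eq_flat
        (hasMFDerivAt_extChartAt_symm_self e) hκe
      have hf : fderiv 𝕜 (fun s => Ψ' (s, x)) (κ e) = B.comp A :=
        HasFDerivAt.fderiv (𝕜 := 𝕜) (hasMFDerivAt_iff_hasFDerivAt.1 hc)
      have hBC : B.comp C = ContinuousLinearMap.id 𝕜 F :=
        mfderiv_extChartAt_comp_mfderivWithin_extChartAt_symm hxt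
      have hCB : C.comp B = ContinuousLinearMap.id 𝕜 F :=
        mfderivWithin_extChartAt_symm_comp_mfderiv_extChartAt hxt
      have hCi : C.inverse = B := ContinuousLinearMap.inverse_eq hCB hBC
      have hgoal : fderiv 𝕜 (fun s => Ψ' (s, x)) (κ e) z = C.inverse (A z) := by
        rw [hf, hCi]; rfl
      exact hgoal
    have hbr : VectorField.mlieBracket 𝓘(𝕜, F) V Y q =
        (mfderiv 𝓘(𝕜, F) 𝓘(𝕜, F) φ q : F →L[𝕜] F).inverse
          (VectorField.lieBracket 𝕜 (E := F) V' Y' (φ q)) := by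
      have : VectorField.lieBracket 𝕜 (E := F) V' Y' (φ q) = VectorField.lieBracketWithin 𝕜 (E := F) V' Y'
          (φ.symm ⁻¹' univ ∩ range 𝓘(𝕜, F)) (φ q) := by
        rw [preimage_univ, univ_inter, modelWithCornersSelf_coe, range_id,
          VectorField.lieBracketWithin_univ]
      rw [this]
      rfl
    have hid : (mfderiv 𝓘(𝕜, F) 𝓘(𝕜, F) φ q : F →L[𝕜] F) = ContinuousLinearMap.id 𝕜 F :=
      mfderiv_extChartAt_self
    have hinv : ∀ T : F →L[𝕜] F, T = ContinuousLinearMap.id 𝕜 F → ∀ w, T.inverse w = w := by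
      rintro _ rfl w
      rw [ContinuousLinearMap.inverse_id]
      rfl
    refine Eq.trans ?_ (hbr.trans (hinv _ hid _)).symm
    rw [hVe.lieBracket_vectorField_eq EventuallyEq.rfl]
end

/-! ### Product rule for families of linear maps, and maps with zero derivative -/

section
variable {𝕜 : Type*} [RCLike 𝕜]
  {P : Type*} [NormedAddCommGroup P] [NormedSpace 𝕜 P]
  {F : Type*} [NormedAddCommGroup F] [NormedSpace 𝕜 F]
  {N : Type*} [TopologicalSpace N] [ChartedSpace P N]
  {M : Type*} [TopologicalSpace M] [ChartedSpace F M]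

theorem HasMFDerivAt.hasFDerivAt_comp_symm [IsManifold 𝓘(𝕜, P) 1 N]
    {f : N → F} {e : N} {f' : P →L[𝕜] F}
    (hf : HasMFDerivAt 𝓘(𝕜, P) 𝓘(𝕜, F) f e f') :
    HasFDerivAt (fun s => f ((extChartAt 𝓘(𝕜, P) e).symm s)) f' (extChartAt 𝓘(𝕜, P) e e) := by
  have := hf.comp_of_eq_flat (hasMFDerivAt_extChartAt_symm_self e) (extChartAt_to_inv e)
  rw [ContinuousLinearMap.comp_id] at this
  exact hasMFDerivAt_iff_hasFDerivAt.1 this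

theorem HasFDerivAt.hasMFDerivAt_of_comp_symm [IsManifold 𝓘(𝕜, P) 1 N]
    {f : N → F} {e : N} {f' : P →L[𝕜] F}
    (hf : HasFDerivAt (fun s => f ((extChartAt 𝓘(𝕜, P) e).symm s)) f'
      (extChartAt 𝓘(𝕜, P) e e)) :
    HasMFDerivAt 𝓘(𝕜, P) 𝓘(𝕜, F) f e f' := by
  have := (hasMFDerivAt_iff_hasFDerivAt.2 hf).comp_of_eq_flat (hasMFDerivAt_extChartAt_self e) rfl
  rw [ContinuousLinearMap.comp_id] at this
  refine HasMFDerivAt.congr_of_eventuallyEq this ?_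
  filter_upwards [extChartAt_source_mem_nhds (I := 𝓘(𝕜, P)) e] with u hu
  rw [(extChartAt 𝓘(𝕜, P) e).left_inv hu]

/-- Differentiability of `β` is only assumed at each fixed vector. Expanding in a basis of the
finite-dimensional `E` reduces to finitely many scalar products; that `D` is linear follows from
uniqueness of derivatives. -/
theorem hasFDerivAt_linearMap_apply {E : Type*} [NormedAddCommGroup E] [NormedSpace 𝕜 E]
    [FiniteDimensional 𝕜 E] {β : P → E →ₗ[𝕜] F} {s : P} {D : E → P →L[𝕜] F}
    (hβ : ∀ x, HasFDerivAt (fun u => β u x) (D x) s) {a : P → E} {a' : P →L[𝕜] E}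
    (ha : HasFDerivAt a a' s) :
    HasFDerivAt (fun u => β u (a u))
      (D (a s) + (LinearMap.toContinuousLinearMap (β s)).comp a') s := by
  set b := Module.finBasis 𝕜 E
  have hexp : ∀ (T : E →ₗ[𝕜] F) x, T x = ∑ i, b.coord i x • T (b i) := fun T x => by
    conv_lhs => rw [← b.sum_repr x, map_sum]
    simp only [map_smul, Module.Basis.coord_apply]
  have hc : ∀ i, HasFDerivAt (fun u => b.coord i (a u))
      ((LinearMap.toContinuousLinearMap (b.coord i)).comp a') s := fun i =>
    (LinearMap.toContinuousLinearMap (b.coord i)).hasFDerivAt.comp s ha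
  have hs : HasFDerivAt (fun u => ∑ i, b.coord i (a u) • β u (b i))
      (∑ i, (b.coord i (a s) • D (b i) +
        ((LinearMap.toContinuousLinearMap (b.coord i)).comp a').smulRight (β s (b i)))) s :=
    HasFDerivAt.fun_sum fun i _ => (hc i).fun_smul (hβ (b i))
  have hD : D (a s) = ∑ i, b.coord i (a s) • D (b i) := by
    refine (hβ (a s)).unique (HasFDerivAt.congr_of_eventuallyEq
      (HasFDerivAt.fun_sum (u := Finset.univ) fun i _ => (hβ (b i)).const_smul (b.coord i (a s))) ?_)
    exact Eventually.of_forall fun u => hexp _ _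
  refine (hs.congr_fderiv ?_).congr_of_eventuallyEq ?_
  · rw [Finset.sum_add_distrib, ← hD]
    congr 1
    ext z
    simpa using (hexp (β s) (a' z)).symm
  · exact Eventually.of_forall fun u => hexp _ _

theorem hasMFDerivAt_linearMap_apply [IsManifold 𝓘(𝕜, P) 1 N]
    {E : Type*} [NormedAddCommGroup E] [NormedSpace 𝕜 E]
    [FiniteDimensional 𝕜 E] {β : N → E →ₗ[𝕜] F} {e : N} {D : E → P →L[𝕜] F}
    (hβ : ∀ x, HasMFDerivAt 𝓘(𝕜, P) 𝓘(𝕜, F) (fun u => β u x) e (D x))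
    {a : N → E} {a' : P →L[𝕜] E} (ha : HasMFDerivAt 𝓘(𝕜, P) 𝓘(𝕜, E) a e a') :
    HasMFDerivAt 𝓘(𝕜, P) 𝓘(𝕜, F) (fun u => β u (a u)) e
      (D (a e) + (LinearMap.toContinuousLinearMap (β e)).comp a') := by
  apply HasFDerivAt.hasMFDerivAt_of_comp_symm
  have := hasFDerivAt_linearMap_apply (fun x => (hβ x).hasFDerivAt_comp_symm)
    ha.hasFDerivAt_comp_symm
  rwa [extChartAt_to_inv] at this

theorem eventually_eq_of_hasMFDerivAt_zero [IsManifold 𝓘(𝕜, P) ∞ N] [IsManifold 𝓘(𝕜, F) ∞ M]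
    {f : N → M} {e : N}
    (hf : ∀ᶠ u in 𝓝 e, HasMFDerivAt 𝓘(𝕜, P) 𝓘(𝕜, F) f u (0 : P →L[𝕜] F)) :
    ∀ᶠ u in 𝓝 e, f u = f e := by
  have : IsManifold 𝓘(𝕜, P) 1 N := .of_le (n := ∞) (by simp)
  have : IsManifold 𝓘(𝕜, F) 1 M := .of_le (n := ∞) (by simp)
  set κ := extChartAt 𝓘(𝕜, P) e with hκ
  set φ := extChartAt 𝓘(𝕜, F) (f e) with hφ
  have hκe : κ.symm (κ e) = e := extChartAt_to_inv e
  have hκt : Tendsto κ.symm (𝓝 (κ e)) (𝓝 e) := by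
    have := (continuousAt_extChartAt_symm (I := 𝓘(𝕜, P)) e).tendsto
    rwa [extChartAt_to_inv] at this
  have hfe : Tendsto f (𝓝 e) (𝓝 (f e)) := hf.self_of_nhds.continuousAt
  set g : P → F := fun s => φ (f (κ.symm s)) with hg
  have hgd : ∀ᶠ s in 𝓝 (κ e), HasFDerivAt g (0 : P →L[𝕜] F) s := by
    filter_upwards [hκt.eventually hf, extChartAt_target_mem_nhds (I := 𝓘(𝕜, P)) e,
      (hfe.comp hκt).eventually (extChartAt_source_mem_nhds (I := 𝓘(𝕜, F)) (f e))]
      with s hs hst hss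
    have h1 : MDifferentiableAt 𝓘(𝕜, P) 𝓘(𝕜, P) κ.symm s :=
      ((contMDiffOn_extChartAt_symm (n := 1) e).contMDiffAt
        ((isOpen_extChartAt_target e).mem_nhds hst)).mdifferentiableAt (by simp)
    have h2 : MDifferentiableAt 𝓘(𝕜, F) 𝓘(𝕜, F) φ (f (κ.symm s)) :=
      mdifferentiableAt_extChartAt (by
        have : f (κ.symm s) ∈ φ.source := hss
        rwa [hφ, extChartAt_source] at this)
    have h3 := h2.hasMFDerivAt.comp_of_eq_flat (hs.comp_of_eq_flat h1.hasMFDerivAt rfl) rfl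
    have h4 := hasMFDerivAt_iff_hasFDerivAt.1 h3
    have h5 : ∀ (B : F →L[𝕜] F) (A : P →L[𝕜] P), B.comp ((0 : P →L[𝕜] F).comp A) = 0 :=
      fun B A => by simp
    exact h4.congr_fderiv (h5 _ _)
  obtain ⟨S, hS, hSo, heS⟩ := eventually_nhds_iff.1 hgd
  let : NormedSpace ℝ P := .restrictScalars ℝ 𝕜 P
  have hopen := hSo.isOpen_inter_preimage_of_fderiv_eq_zero (𝕜 := 𝕜) (f := g)
    (fun s hs => (hS s hs).differentiableAt.differentiableWithinAt)
    (fun s hs => (hS s hs).fderiv) {g (κ e)}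
  have hev := hopen.mem_nhds ⟨heS, rfl⟩
  have hκc : Tendsto κ (𝓝 e) (𝓝 (κ e)) := (continuousAt_extChartAt (I := 𝓘(𝕜, P)) e).tendsto
  filter_upwards [hκc.eventually hev, extChartAt_source_mem_nhds (I := 𝓘(𝕜, P)) e,
    hfe.eventually (extChartAt_source_mem_nhds (I := 𝓘(𝕜, F)) (f e))] with u hu hus huf
  have h5 : g (κ u) = g (κ e) := hu.2
  simp only [hg, hκe] at h5
  rw [κ.left_inv hus] at h5
  exact φ.injOn huf (mem_extChartAt_source _) h5

theorem eq_of_hasMFDerivAt_zero [IsManifold 𝓘(𝕜, P) ∞ N] [IsManifold 𝓘(𝕜, F) ∞ M]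
    [PreconnectedSpace N] {f : N → M}
    (hf : ∀ u, HasMFDerivAt 𝓘(𝕜, P) 𝓘(𝕜, F) f u (0 : P →L[𝕜] F)) (u v : N) : f u = f v :=
  ((IsLocallyConstant.iff_eventually_eq f).2 fun _ =>
    eventually_eq_of_hasMFDerivAt_zero (Eventually.of_forall hf)).apply_eq_of_preconnectedSpace u v
end

theorem HasMFDerivAt.congr_flat {𝕜 : Type*} [NontriviallyNormedField 𝕜]
    {E : Type*} [NormedAddCommGroup E] [NormedSpace 𝕜 E] {B : Type*} [TopologicalSpace B]
    {I : ModelWithCorners 𝕜 E B} {X : Type*} [TopologicalSpace X] [ChartedSpace B X]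
    {E' : Type*} [NormedAddCommGroup E'] [NormedSpace 𝕜 E'] {B' : Type*} [TopologicalSpace B']
    {I' : ModelWithCorners 𝕜 E' B'} {X' : Type*} [TopologicalSpace X'] [ChartedSpace B' X']
    {f g : X → X'} {x : X} {f' : E →L[𝕜] E'}
    (hf : HasMFDerivAt I I' f x f') (h : ∀ x, g x = f x) :
    HasMFDerivAt I I' g x f' := by
  obtain rfl : g = f := funext h
  exact hf

theorem congr_section {𝕜 : Type*} [RCLike 𝕜]
    {F : Type*} [NormedAddCommGroup F] [NormedSpace 𝕜 F]
    {M : Type*} [TopologicalSpace M] [ChartedSpace F M]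
    (Y : ∀ p : M, TangentSpace 𝓘(𝕜, F) p) {p q : M} (h : p = q) :
    (Y p : F) = (Y q : F) := by
  subst h; rfl

/-! ### The adjoint representation and its derivative -/

section
variable {𝕜 : Type*} [RCLike 𝕜]
  {EG : Type*} [NormedAddCommGroup EG] [NormedSpace 𝕜 EG]
  {EH : Type*} [NormedAddCommGroup EH] [NormedSpace 𝕜 EH]
  {F : Type*} [NormedAddCommGroup F] [NormedSpace 𝕜 F]
  {G : Type*} [TopologicalSpace G] [ChartedSpace EG G] [Group G] [LieGroup 𝓘(𝕜, EG) ∞ G]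
  {H : Type*} [TopologicalSpace H] [ChartedSpace EH H] [Group H] [LieGroup 𝓘(𝕜, EH) ∞ H]
  {M : Type*} [TopologicalSpace M] [ChartedSpace F M] [IsManifold 𝓘(𝕜, F) ∞ M]

/-- The adjoint representation `Ad g : T₁G → T₁G` of a Lie group. -/
noncomputable def adjointMap (𝕜 : Type*) [RCLike 𝕜]
    {EG : Type*} [NormedAddCommGroup EG] [NormedSpace 𝕜 EG]
    {G : Type*} [TopologicalSpace G] [ChartedSpace EG G] [Group G] (g : G) : EG →L[𝕜] EG :=
  (mfderiv 𝓘(𝕜, EG) 𝓘(𝕜, EG) (fun x : G => g * x * g⁻¹) 1 : EG →L[𝕜] EG)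

theorem contMDiff_conj (g : G) :
    ContMDiff 𝓘(𝕜, EG) 𝓘(𝕜, EG) ∞ (fun x : G => g * x * g⁻¹) :=
  (contMDiff_mul_right (a := g⁻¹)).comp (contMDiff_mul_left (a := g))

theorem hasMFDerivAt_conj (g : G) :
    HasMFDerivAt 𝓘(𝕜, EG) 𝓘(𝕜, EG) (fun x : G => g * x * g⁻¹) 1
      (adjointMap 𝕜 (EG := EG) g) :=
  ((contMDiff_conj g).mdifferentiable (by simp) 1).hasMFDerivAt

theorem adjointMap_one : adjointMap 𝕜 (1 : G) = ContinuousLinearMap.id 𝕜 EG := by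
  have h := (hasMFDerivAt_conj (𝕜 := 𝕜) (EG := EG) (1 : G)).congr_flat (g := id) (by simp)
  exact hasMFDerivAt_unique h (hasMFDerivAt_id 1)

theorem adjointMap_mul (g h : G) :
    adjointMap 𝕜 (EG := EG) (g * h) = (adjointMap 𝕜 g).comp (adjointMap 𝕜 h) := by
  have h1 := (hasMFDerivAt_conj (𝕜 := 𝕜) (EG := EG) g).comp_of_eq_flat
    (hasMFDerivAt_conj (EG := EG) h) (by simp)
  have h2 := hasMFDerivAt_conj (𝕜 := 𝕜) (EG := EG) (g * h)
  exact hasMFDerivAt_unique h2 (h1.congr_flat fun x => by group)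

/-- `Ad g` is left translation by `g` followed by right translation by `g⁻¹`. A left-invariant field
takes at `g` the left translate of `X`, and pulling back by right translation brings it to `1`. -/
theorem pullbackFamily_mul_right_one {H : Type*} (j : H → G) (X : EG) (u : H) :
    pullbackFamily 𝕜 (fun y : H × G => y.2 * j y.1)
      (mulInvariantVectorField (I := 𝓘(𝕜, EG)) (G := G) X) 1 u = adjointMap 𝕜 (j u) X := by
  have hA := ((contMDiff_mul_right (I := 𝓘(𝕜, EG)) (n := ∞) (a := j u)).mdifferentiable
    (by simp) 1).hasMFDerivAt
  have hB := ((contMDiff_mul_right (I := 𝓘(𝕜, EG)) (n := ∞) (a := (j u)⁻¹)).mdifferentiable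
    (by simp) (j u)).hasMFDerivAt
  have hL := ((contMDiff_mul_left (I := 𝓘(𝕜, EG)) (n := ∞) (a := j u)).mdifferentiable
    (by simp) 1).hasMFDerivAt
  set A : EG →L[𝕜] EG := mfderiv 𝓘(𝕜, EG) 𝓘(𝕜, EG) (fun x : G => x * j u) 1
  set B : EG →L[𝕜] EG := mfderiv 𝓘(𝕜, EG) 𝓘(𝕜, EG) (fun x : G => x * (j u)⁻¹) (j u)
  set L : EG →L[𝕜] EG := mfderiv 𝓘(𝕜, EG) 𝓘(𝕜, EG) (fun x : G => j u * x) 1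
  have hBA : B.comp A = ContinuousLinearMap.id 𝕜 EG := by
    have h := (hB.comp_of_eq_flat hA (one_mul _)).congr_flat (g := id) (by simp)
    exact hasMFDerivAt_unique h (hasMFDerivAt_id 1)
  have hAB : A.comp B = ContinuousLinearMap.id 𝕜 EG := by
    have h := (hA.comp_of_eq_flat hB (mul_inv_cancel _)).congr_flat (g := id) (by simp)
    exact hasMFDerivAt_unique h (hasMFDerivAt_id (j u))
  have hBL : adjointMap 𝕜 (EG := EG) (j u) = B.comp L :=
    hasMFDerivAt_unique (hasMFDerivAt_conj (EG := EG) (j u)) (hB.comp_of_eq_flat hL (mul_one _))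
  have h1 : pullbackFamily 𝕜 (fun y : H × G => y.2 * j y.1)
      (mulInvariantVectorField (I := 𝓘(𝕜, EG)) (G := G) X) 1 u = A.inverse (L X) := by
    have : (mulInvariantVectorField (I := 𝓘(𝕜, EG)) (G := G) X (1 * j u) : EG) = L X :=
      congr_section _ (one_mul _)
    rw [← this]
    rfl
  rw [h1, ContinuousLinearMap.inverse_eq hAB hBA, hBL]
  rfl

/-- The Lie derivative formula is applied to the right translations `x ↦ x * j u`. Their generator
in the direction `z` is the left-invariant field of the image of `z`, so the bracket of fields at
`1` is the Lie algebra bracket. -/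
theorem hasMFDerivAt_adjointMap_apply [CompleteSpace EG] (j : H →* G)
    (hj : ContMDiff 𝓘(𝕜, EH) 𝓘(𝕜, EG) ∞ j) (X : LieAlg 𝕜 EG G) :
    ∃ L : EH →L[𝕜] EG,
      HasMFDerivAt 𝓘(𝕜, EH) 𝓘(𝕜, EG) (fun u : H => adjointMap 𝕜 (EG := EG) (j u) X) 1 L ∧
      ∀ z : LieAlg 𝕜 EH H, L z = ⁅lieAlgMap 𝕜 (E := EH) (E' := EG) j z, X⁆ := by
  have : LieGroup 𝓘(𝕜, EG) (minSmoothness 𝕜 3) G := .of_le (n := ∞)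
    (by rw [minSmoothness_of_isRCLikeNormedField]; exact WithTop.coe_le_coe.2 le_top)
  have : IsManifold 𝓘(𝕜, EG) ∞ G := (inferInstance : LieGroup 𝓘(𝕜, EG) ∞ G).toContMDiffMul.toIsManifold
  have : IsManifold 𝓘(𝕜, EH) ∞ H := (inferInstance : LieGroup 𝓘(𝕜, EH) ∞ H).toContMDiffMul.toIsManifold
  have hΨ : ContMDiff (𝓘(𝕜, EH).prod 𝓘(𝕜, EG)) 𝓘(𝕜, EG) ∞ (fun y : H × G => y.2 * j y.1) :=
    contMDiff_snd.mul (hj.comp contMDiff_fst)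
  obtain ⟨L, hL, hLz⟩ := hasMFDerivAt_pullbackFamily (e := (1 : H)) (q := (1 : G))
    hΨ.contMDiffAt (by simp) (mdifferentiableAt_mulInvariantVectorField (I := 𝓘(𝕜, EG)) X)
  refine ⟨L, ?_, fun z => (hLz z).trans ?_⟩
  · have h : pullbackFamily 𝕜 (fun y : H × G => y.2 * j y.1)
      (mulInvariantVectorField (I := 𝓘(𝕜, EG)) (G := G) X) 1 =
        fun u : H => adjointMap 𝕜 (EG := EG) (j u) X := 
      funext (pullbackFamily_mul_right_one (EG := EG) j X)
    rwa [← h]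
  · rw [GroupLieAlgebra.bracket_def]
    congr 1
    funext x
    have hj1 := (hj.mdifferentiable (by simp) 1).hasMFDerivAt
    have hL := ((contMDiff_mul_left (I := 𝓘(𝕜, EG)) (n := ∞) (a := x)).mdifferentiable
      (by simp) 1).hasMFDerivAt
    have h := (hL.comp_of_eq_flat hj1 (map_one j)).mfderiv
    exact congrArg (fun T : EH →L[𝕜] EG => T z) h
end

theorem Integrates.mfderiv_apply {𝕜 : Type*} [RCLike 𝕜]
    {E : Type*} [NormedAddCommGroup E] [NormedSpace 𝕜 E]
    {G : Type*} [TopologicalSpace G] [ChartedSpace E G] [Group G]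
    {F : Type*} [NormedAddCommGroup F] [NormedSpace 𝕜 F]
    {M : Type*} [TopologicalSpace M] [ChartedSpace F M] [IsManifold 𝓘(𝕜, F) ∞ M]
    {Φ : G × M → M} {ρ : LieAlg 𝕜 E G →ₗ[𝕜] SmoothVectorField 𝕜 F M} (h : Integrates Φ ρ)
    (X : E) (p : M) :
    (mfderiv 𝓘(𝕜, E) 𝓘(𝕜, F) (fun g : G => Φ (g, p)) 1 : E →L[𝕜] F) X = -(ρ X p : F) := by
  have hneg : ∀ (T : E →L[𝕜] F) (w : F), w = T (-X) → T X = -w := by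
    rintro T w rfl
    rw [map_neg, neg_neg]
  exact hneg _ _ (h X p)

theorem pullbackFamily_of_act_one {𝕜 : Type*} [RCLike 𝕜]
    {F : Type*} [NormedAddCommGroup F] [NormedSpace 𝕜 F]
    {M : Type*} [TopologicalSpace M] [ChartedSpace F M]
    {H : Type*} [Group H] {Ψ : H × M → M} (h0 : ∀ p, Ψ (1, p) = p)
    (Y : ∀ p : M, TangentSpace 𝓘(𝕜, F) p) (q : M) : pullbackFamily 𝕜 Ψ Y q 1 = Y q := by
  have h : HasMFDerivAt 𝓘(𝕜, F) 𝓘(𝕜, F) (fun p => Ψ (1, p)) q (ContinuousLinearMap.id 𝕜 F) :=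
    HasMFDerivAt.congr_flat (f := id) (hasMFDerivAt_id q) h0
  have hinv : ∀ T : F →L[𝕜] F, T = ContinuousLinearMap.id 𝕜 F → ∀ w, T.inverse w = w := by
    rintro _ rfl w
    rw [ContinuousLinearMap.inverse_id]
    rfl
  exact (hinv _ h.mfderiv _).trans (congr_section Y (h0 q))

/-! ### Transformations from `H` carry `ρ X` to `ρ (Ad X)` -/

section
variable {𝕜 : Type*} [RCLike 𝕜]
  {EG : Type*} [NormedAddCommGroup EG] [NormedSpace 𝕜 EG] [FiniteDimensional 𝕜 EG]
  {EH : Type*} [NormedAddCommGroup EH] [NormedSpace 𝕜 EH]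
  {F : Type*} [NormedAddCommGroup F] [NormedSpace 𝕜 F] [FiniteDimensional 𝕜 F]
  {G : Type*} [TopologicalSpace G] [ChartedSpace EG G] [Group G] [LieGroup 𝓘(𝕜, EG) ∞ G]
  {H : Type*} [TopologicalSpace H] [ChartedSpace EH H] [Group H] [LieGroup 𝓘(𝕜, EH) ∞ H]
  {M : Type*} [TopologicalSpace M] [ChartedSpace F M] [IsManifold 𝓘(𝕜, F) ∞ M]

/-- The pullbacks at `q` under `Ψ (u, ·)` of the vector fields `ρ X`, as a linear map in `X`. -/
noncomputable def pullbackFamilyLinear (Ψ : H × M → M)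
    (ρ : LieAlg 𝕜 EG G →ₗ[𝕜] SmoothVectorField 𝕜 F M) (q : M) (u : H) : EG →ₗ[𝕜] F where
  toFun X := pullbackFamily 𝕜 Ψ (fun p => ρ X p) q u
  map_add' X Y := by
    have h : ρ ((X : LieAlg 𝕜 EG G) + Y) = ρ X + ρ Y := map_add ρ _ _
    have h' : ∀ p, ρ ((X : LieAlg 𝕜 EG G) + Y) p = ρ X p + ρ Y p := fun p => by rw [h]; rfl
    set A : F →L[𝕜] F := mfderiv 𝓘(𝕜, F) 𝓘(𝕜, F) (fun p => Ψ (u, p)) q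
    change A.inverse (ρ ((X : LieAlg 𝕜 EG G) + Y) (Ψ (u, q))) =
      A.inverse (ρ X (Ψ (u, q))) + A.inverse (ρ Y (Ψ (u, q)))
    rw [h']
    exact map_add A.inverse _ _
  map_smul' c X := by
    have h : ρ (c • (X : LieAlg 𝕜 EG G)) = c • ρ X := map_smul ρ _ _
    have h' : ∀ p, ρ (c • (X : LieAlg 𝕜 EG G)) p = c • ρ X p := fun p => by rw [h]; rfl
    set A : F →L[𝕜] F := mfderiv 𝓘(𝕜, F) 𝓘(𝕜, F) (fun p => Ψ (u, p)) q
    change A.inverse (ρ (c • (X : LieAlg 𝕜 EG G)) (Ψ (u, q))) = c • A.inverse (ρ X (Ψ (u, q)))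
    rw [h']
    exact map_smul A.inverse _ _

variable {j : H →* G} {Ψ : H × M → M} {ρ : LieAlg 𝕜 EG G →ₗ[𝕜] SmoothVectorField 𝕜 F M}

/-- Let `Z` be the image of `z`. By the sign convention the generator of `Ψ` along `z` is `-ρ Z`, so
moving the transformation contributes `-ρ ⁅Z, X⁆` at `q`, and moving `Ad` contributes `ρ ⁅Z, X⁆`. -/
theorem hasMFDerivAt_pullbackFamily_adjointMap_one
    (hj : ContMDiff 𝓘(𝕜, EH) 𝓘(𝕜, EG) ∞ j)
    (hρ : IsVectorFieldRepresentation ρ)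
    (hΨ : ContMDiff (𝓘(𝕜, EH).prod 𝓘(𝕜, F)) 𝓘(𝕜, F) ∞ Ψ) (h0 : ∀ p, Ψ (1, p) = p)
    (hint : Integrates Ψ (ρ ∘ₗ lieAlgMap 𝕜 (E := EH) (E' := EG) j)) (X : LieAlg 𝕜 EG G) (q : M) :
    HasMFDerivAt 𝓘(𝕜, EH) 𝓘(𝕜, F)
      (fun u => pullbackFamilyLinear Ψ ρ q u (adjointMap 𝕜 (EG := EG) (j u) X)) 1
      (0 : EH →L[𝕜] F) := by
  have : CompleteSpace F := FiniteDimensional.complete 𝕜 F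
  have : CompleteSpace EG := FiniteDimensional.complete 𝕜 EG
  have hk : ∀ Z : EG, ∃ L : EH →L[𝕜] F, HasMFDerivAt 𝓘(𝕜, EH) 𝓘(𝕜, F)
      (fun u => pullbackFamilyLinear Ψ ρ q u Z) 1 L ∧
      ∀ z : EH, L z = VectorField.mlieBracket 𝓘(𝕜, F) (generatorField 𝕜 Ψ 1 z)
        (fun p => ρ Z p) q := fun Z =>
    hasMFDerivAt_pullbackFamily hΨ.contMDiffAt h0
      ((ρ Z).contMDiff.mdifferentiable (by simp) q)
  choose D hD hDz using hk
  obtain ⟨L, hL, hLz⟩ := hasMFDerivAt_adjointMap_apply j hj X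
  have h := hasMFDerivAt_linearMap_apply hD hL
  have hzero : D (adjointMap 𝕜 (EG := EG) (j 1) X) +
      (LinearMap.toContinuousLinearMap (pullbackFamilyLinear Ψ ρ q 1)).comp L = 0 := by
    ext z
    have hX : adjointMap 𝕜 (EG := EG) (j 1) X = X := by
      rw [map_one, adjointMap_one]; rfl
    set Z : LieAlg 𝕜 EG G := lieAlgMap 𝕜 (E := EH) (E' := EG) j z with hZ
    have h1 : generatorField 𝕜 Ψ 1 z = (-1 : 𝕜) • (fun p => ρ Z p) := by
      funext p
      have h2 : generatorField 𝕜 Ψ 1 z p = -(ρ Z p : F) := hint.mfderiv_apply z p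
      exact h2.trans (neg_one_smul 𝕜 (ρ Z p : F)).symm
    have h5 : D (adjointMap 𝕜 (EG := EG) (j 1) X) z = -(ρ ⁅Z, X⁆ q : F) := by
      have h7 := VectorField.mlieBracket_const_smul_left (c := (-1 : 𝕜))
        (W := fun p => ρ X p) ((ρ Z).contMDiff.mdifferentiable (by simp) q)
      rw [hX]
      refine (hDz X z).trans ?_
      rw [h1]
      exact h7.trans ((congrArg (fun w : F => (-1 : 𝕜) • w) (hρ Z X q).symm).trans
        (neg_one_smul 𝕜 (ρ ⁅Z, X⁆ q : F)))
    have h6 : pullbackFamilyLinear Ψ ρ q 1 (L z) = ρ ⁅Z, X⁆ q := by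
      refine (congrArg (pullbackFamilyLinear Ψ ρ q 1) (hLz z)).trans ?_
      exact pullbackFamily_of_act_one h0 _ q
    change D (adjointMap 𝕜 (EG := EG) (j 1) X) z + pullbackFamilyLinear Ψ ρ q 1 (L z) = 0
    refine (congrArg₂ (· + ·) h5 h6).trans ?_
    exact neg_add_cancel (G := F) _
  rwa [hzero] at h

end

/-- The derivative at `q` of the transformation `Ψ (u, ·)`. -/
noncomputable def actDeriv (𝕜 : Type*) [RCLike 𝕜]
    (F : Type*) [NormedAddCommGroup F] [NormedSpace 𝕜 F]
    {H : Type*} {M : Type*} [TopologicalSpace M] [ChartedSpace F M]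
    (Ψ : H × M → M) (u : H) (q : M) : F →L[𝕜] F :=
  (mfderiv 𝓘(𝕜, F) 𝓘(𝕜, F) (fun p => Ψ (u, p)) q : F →L[𝕜] F)

section
variable {𝕜 : Type*} [RCLike 𝕜]
  {EH : Type*} [NormedAddCommGroup EH] [NormedSpace 𝕜 EH]
  {F : Type*} [NormedAddCommGroup F] [NormedSpace 𝕜 F]
  {H : Type*} [TopologicalSpace H] [ChartedSpace EH H] [Group H]
  {M : Type*} [TopologicalSpace M] [ChartedSpace F M]
  {Ψ : H × M → M}

theorem hasMFDerivAt_act {H : Type*} [TopologicalSpace H] [ChartedSpace EH H]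
    {Ψ : H × M → M} (hΨ : ContMDiff (𝓘(𝕜, EH).prod 𝓘(𝕜, F)) 𝓘(𝕜, F) ∞ Ψ) (u : H) (q : M) :
    HasMFDerivAt 𝓘(𝕜, F) 𝓘(𝕜, F) (fun p => Ψ (u, p)) q
      (actDeriv 𝕜 F Ψ u q) :=
  ((hΨ.mdifferentiable (by simp) (u, q)).comp q
    (mdifferentiableAt_const.prodMk mdifferentiableAt_id)).hasMFDerivAt

theorem isInvertible_mfderiv_act (hΨ : ContMDiff (𝓘(𝕜, EH).prod 𝓘(𝕜, F)) 𝓘(𝕜, F) ∞ Ψ)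
    (h0 : ∀ p, Ψ (1, p) = p) (hm : ∀ u v p, Ψ (u * v, p) = Ψ (u, Ψ (v, p))) (u : H) (q : M) :
    ContinuousLinearMap.IsInvertible (actDeriv 𝕜 F Ψ u q) := by
  have hA := hasMFDerivAt_act hΨ u q
  have hB := hasMFDerivAt_act hΨ u⁻¹ (Ψ (u, q))
  refine ContinuousLinearMap.IsInvertible.of_inverse
    (g := (actDeriv 𝕜 F Ψ u⁻¹ (Ψ (u, q)))) ?_ ?_
  · have h := (hA.comp_of_eq_flat hB (by rw [← hm, inv_mul_cancel, h0])).congr_flat (g := id)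
      (fun x => by rw [← hm, mul_inv_cancel, h0]; rfl)
    exact hasMFDerivAt_unique h (hasMFDerivAt_id (Ψ (u, q)))
  · have h := (hB.comp_of_eq_flat hA rfl).congr_flat (g := id)
      (fun x => by rw [← hm, inv_mul_cancel, h0]; rfl)
    exact hasMFDerivAt_unique h (hasMFDerivAt_id q)

/-- This cocycle identity is the chain rule for `Ψ (u * v, ·)`; it transports information at `u = 1`
to every point of `H`. -/
theorem pullbackFamily_mul (hΨ : ContMDiff (𝓘(𝕜, EH).prod 𝓘(𝕜, F)) 𝓘(𝕜, F) ∞ Ψ)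
    (h0 : ∀ p, Ψ (1, p) = p) (hm : ∀ u v p, Ψ (u * v, p) = Ψ (u, Ψ (v, p)))
    (Y : ∀ p : M, TangentSpace 𝓘(𝕜, F) p) (q : M) (u v : H) :
    pullbackFamily 𝕜 Ψ Y q (u * v) =
      ContinuousLinearMap.inverse (actDeriv 𝕜 F Ψ v q)
        (pullbackFamily 𝕜 Ψ Y (Ψ (v, q)) u) := by
  have hA := hasMFDerivAt_act hΨ v q
  have hAi := isInvertible_mfderiv_act hΨ h0 hm v q
  have hB := hasMFDerivAt_act hΨ u (Ψ (v, q))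
  have hAB := (hB.comp_of_eq_flat hA rfl).congr_flat (g := fun p => Ψ (u * v, p)) (hm u v)
  set A : F →L[𝕜] F := actDeriv 𝕜 F Ψ v q
  set B : F →L[𝕜] F := actDeriv 𝕜 F Ψ u (Ψ (v, q))
  have h1 : pullbackFamily 𝕜 Ψ Y q (u * v) =
      ContinuousLinearMap.inverse (actDeriv 𝕜 F Ψ (u * v) q)
        (Y (Ψ (u * v, q)) : F) := rfl
  have h2 : pullbackFamily 𝕜 Ψ Y (Ψ (v, q)) u = B.inverse (Y (Ψ (u, Ψ (v, q))) : F) := rfl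
  have h3 : (actDeriv 𝕜 F Ψ (u * v) q) = B.comp A :=
    hAB.mfderiv
  have h4 : ∀ w w' : F, w = w' → (B.comp A).inverse w = A.inverse (B.inverse w') := by
    rintro w _ rfl
    rw [hAi.inverse_comp_apply_of_right]
  rw [h1, h2, h3]
  exact h4 _ _ (congr_section Y (hm u v q))

end

/-- The pullback of `ρ (Ad u X)` is a function `f X q` of `u` with zero derivative at `1`, for all
`X` and `q`. Near any `u` it is, by `hmul`, a fixed linear map applied to another such function near
`1`. Hence it is constant on the connected `H`, equal to its value `ρ X q` at `1`. -/
theorem mfderiv_act_apply_eq_adjointMap {𝕜 : Type*} [RCLike 𝕜]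
    {EG : Type*} [NormedAddCommGroup EG] [NormedSpace 𝕜 EG] [FiniteDimensional 𝕜 EG]
    {EH : Type*} [NormedAddCommGroup EH] [NormedSpace 𝕜 EH]
    {F : Type*} [NormedAddCommGroup F] [NormedSpace 𝕜 F] [FiniteDimensional 𝕜 F]
    {G : Type*} [TopologicalSpace G] [ChartedSpace EG G] [Group G] [LieGroup 𝓘(𝕜, EG) ∞ G]
    {H : Type*} [TopologicalSpace H] [ChartedSpace EH H] [Group H] [LieGroup 𝓘(𝕜, EH) ∞ H]
    [ConnectedSpace H]
    {M : Type*} [TopologicalSpace M] [ChartedSpace F M] [IsManifold 𝓘(𝕜, F) ∞ M]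
    {j : H →* G} {Ψ : H × M → M} {ρ : LieAlg 𝕜 EG G →ₗ[𝕜] SmoothVectorField 𝕜 F M}
    (hj : ContMDiff 𝓘(𝕜, EH) 𝓘(𝕜, EG) ∞ j)
    (hρ : IsVectorFieldRepresentation ρ)
    (hΨ : ContMDiff (𝓘(𝕜, EH).prod 𝓘(𝕜, F)) 𝓘(𝕜, F) ∞ Ψ) (h0 : ∀ p, Ψ (1, p) = p)
    (hm : ∀ u v p, Ψ (u * v, p) = Ψ (u, Ψ (v, p)))
    (hint : Integrates Ψ (ρ ∘ₗ lieAlgMap 𝕜 (E := EH) (E' := EG) j)) (X : EG) (q : M) (u : H) :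
    (actDeriv 𝕜 F Ψ u q) (ρ X q) =
      (ρ (adjointMap 𝕜 (EG := EG) (j u) X) (Ψ (u, q)) : F) := by
  have : IsManifold 𝓘(𝕜, EH) ∞ H :=
    (inferInstance : LieGroup 𝓘(𝕜, EH) ∞ H).toContMDiffMul.toIsManifold
  set f : EG → M → H → F := fun X q u =>
    pullbackFamilyLinear Ψ ρ q u (adjointMap 𝕜 (EG := EG) (j u) X) with hf
  have hone : ∀ X q, HasMFDerivAt 𝓘(𝕜, EH) 𝓘(𝕜, F) (f X q) 1 (0 : EH →L[𝕜] F) := fun X q =>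
    hasMFDerivAt_pullbackFamily_adjointMap_one hj hρ hΨ h0 hint X q
  have hmul : ∀ X q u v, f X q (u * v) =
      ContinuousLinearMap.inverse (actDeriv 𝕜 F Ψ v q)
        (f (adjointMap 𝕜 (EG := EG) (j v) X) (Ψ (v, q)) u) := fun X q u v => by
    simp only [hf]
    rw [map_mul, adjointMap_mul]
    exact pullbackFamily_mul hΨ h0 hm _ q u v
  have hzero : ∀ u, HasMFDerivAt 𝓘(𝕜, EH) 𝓘(𝕜, F) (f X q) u (0 : EH →L[𝕜] F) := fun u => by
    set A : F →L[𝕜] F :=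
      ContinuousLinearMap.inverse (actDeriv 𝕜 F Ψ u q) with hA
    have h1 : HasMFDerivAt 𝓘(𝕜, EH) 𝓘(𝕜, EH) (fun v : H => v * u⁻¹) u _ :=
      ((contMDiff_mul_right (I := 𝓘(𝕜, EH)) (n := ∞) (a := u⁻¹)).mdifferentiable
        (by simp) u).hasMFDerivAt
    have h2 := (hone (adjointMap 𝕜 (EG := EG) (j u) X) (Ψ (u, q))).comp_of_eq_flat h1
      (mul_inv_cancel u)
    have h3 := (A.hasMFDerivAt (x := f (adjointMap 𝕜 (EG := EG) (j u) X) (Ψ (u, q))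
      (u * u⁻¹))).comp_of_eq_flat h2 rfl
    have h4 : ∀ T : EH →L[𝕜] EH, A.comp ((0 : EH →L[𝕜] F).comp T) = 0 := fun T => by simp
    refine HasMFDerivAt.congr_flat (HasMFDerivAt.congr_mfderiv h3 (h4 _)) fun v => ?_
    rw [← hmul, inv_mul_cancel_right]
  have hconst := eq_of_hasMFDerivAt_zero hzero u 1
  have h1 : f X q 1 = (ρ X q : F) := by
    simp only [hf]
    rw [map_one, adjointMap_one]
    exact pullbackFamily_of_act_one h0 _ q
  rw [h1] at hconst
  have hAi := isInvertible_mfderiv_act hΨ h0 hm u q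
  set A : F →L[𝕜] F := actDeriv 𝕜 F Ψ u q
  have h2 : A.inverse (ρ (adjointMap 𝕜 (EG := EG) (j u) X) (Ψ (u, q)) : F) = (ρ X q : F) := hconst
  rw [← h2]
  exact hAi.self_apply_inverse _

/-! ### Shrinking the domain to connected slices -/

section
variable {K M : Type*} [TopologicalSpace K] [One K]

/-- The part of a domain `Ω ⊆ K × M` whose slice over `p` is the connected component of `1` in the
slice of `Ω` over `p`. -/
def oneComponentDomain (Ω : Set (K × M)) : Set (K × M) :=
  {x | x.1 ∈ connectedComponentIn {k | (k, x.2) ∈ Ω} 1}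

theorem oneComponentDomain_subset (Ω : Set (K × M)) : oneComponentDomain Ω ⊆ Ω :=
  fun x hx => connectedComponentIn_subset {k | (k, x.2) ∈ Ω} 1 hx

theorem isPreconnected_slice_oneComponentDomain (Ω : Set (K × M)) (p : M) :
    IsPreconnected {k | (k, p) ∈ oneComponentDomain Ω} :=
  (isPreconnected_connectedComponentIn :
    IsPreconnected (connectedComponentIn {k | (k, p) ∈ Ω} 1))

theorem one_mem_oneComponentDomain {Ω : Set (K × M)} (h1 : ∀ p : M, ((1 : K), p) ∈ Ω) (p : M) :
    ((1 : K), p) ∈ oneComponentDomain Ω :=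
  mem_connectedComponentIn (h1 p)

theorem subset_slice_oneComponentDomain {Ω : Set (K × M)} {p : M} {U : Set K}
    (hU : IsPreconnected U) (hUΩ : ∀ k ∈ U, (k, p) ∈ Ω) {k : K} (hk : k ∈ U)
    (hk0 : (k, p) ∈ oneComponentDomain Ω) {a : K} (ha : a ∈ U) :
    (a, p) ∈ oneComponentDomain Ω := by
  have h : connectedComponentIn {k | (k, p) ∈ Ω} 1 = connectedComponentIn {k | (k, p) ∈ Ω} k :=
    connectedComponentIn_eq hk0
  change a ∈ connectedComponentIn {k | (k, p) ∈ Ω} 1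
  rw [h]
  exact hU.subset_connectedComponentIn hk hUΩ ha

variable [TopologicalSpace M]

/-- Over a fixed `p`, the set of `k` at which the domain is a neighbourhood of `(k, p)` is open,
contains `1` and is closed relative to the slice, which is connected. -/
theorem isOpen_oneComponentDomain [LocallyConnectedSpace K] {Ω : Set (K × M)} (hΩ : IsOpen Ω)
    (h1 : ∀ p : M, ((1 : K), p) ∈ Ω) : IsOpen (oneComponentDomain Ω) := by
  -- On a product neighbourhood inside `Ω` with connected first factor, a single `k'` lying in the
  -- slices over all nearby points drags the whole first factor into them.
  have step : ∀ k p, (k, p) ∈ Ω → ∃ U ∈ 𝓝 k, ∀ k' ∈ U,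
      (∀ᶠ b in 𝓝 p, (k', b) ∈ oneComponentDomain Ω) → oneComponentDomain Ω ∈ 𝓝 (k, p) := by
    intro k p hkp
    obtain ⟨U, hU, W, hW, hUW⟩ := mem_nhds_prod_iff.1 (hΩ.mem_nhds hkp)
    obtain ⟨U', hU'U, hU'o, hkU', hU'c⟩ :=
      locallyConnectedSpace_iff_subsets_isOpen_isConnected.1 ‹_› k U hU
    refine ⟨U', hU'o.mem_nhds hkU', fun k' hk' hev => ?_⟩
    rw [mem_nhds_prod_iff]
    refine ⟨U', hU'o.mem_nhds hkU', _, inter_mem hW hev, ?_⟩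
    rintro ⟨a, b⟩ ⟨ha, hbW, hb⟩
    exact subset_slice_oneComponentDomain hU'c.isPreconnected
      (fun k hk => hUW ⟨hU'U hk, hbW⟩) hk' hb ha
  rw [isOpen_iff_mem_nhds]
  rintro ⟨k, p⟩ hkp
  set u : Set K := {k | oneComponentDomain Ω ∈ 𝓝 (k, p)} with hu
  have huo : IsOpen u := by
    have : u = (fun k => (k, p)) ⁻¹' interior (oneComponentDomain Ω) := by
      ext k; simp [hu, mem_interior_iff_mem_nhds]
    rw [this]
    exact isOpen_interior.preimage (Continuous.prodMk_left p)
  refine (isPreconnected_slice_oneComponentDomain Ω p).subset_of_closure_inter_subset huo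
    ⟨1, one_mem_oneComponentDomain h1 p, ?_⟩ ?_ hkp
  · obtain ⟨U, hU, h⟩ := step 1 p (h1 p)
    exact h 1 (mem_of_mem_nhds hU) (Eventually.of_forall (one_mem_oneComponentDomain h1))
  · rintro a ⟨hac, ha⟩
    obtain ⟨U, hU, h⟩ := step a p (oneComponentDomain_subset Ω ha)
    obtain ⟨k', hk'U, hk'⟩ := mem_closure_iff_nhds.1 hac U hU
    exact h k' hk'U ((Continuous.prodMk_right k').tendsto p |>.eventually hk')

/-- Each slice is connected and meets `{1} × M`, which is a copy of the connected `M`. -/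
theorem isConnected_oneComponentDomain [ConnectedSpace M] {Ω : Set (K × M)}
    (h1 : ∀ p : M, ((1 : K), p) ∈ Ω) : IsConnected (oneComponentDomain Ω) := by
  obtain ⟨p₀⟩ := (inferInstance : Nonempty M)
  refine ⟨⟨_, one_mem_oneComponentDomain h1 p₀⟩, ?_⟩
  set T : Set (K × M) := range fun p : M => ((1 : K), p) with hT
  have hTc : IsPreconnected T := isPreconnected_range (Continuous.prodMk_right 1)
  have h : oneComponentDomain Ω =
      ⋃ p, ((fun k => (k, p)) '' {k | (k, p) ∈ oneComponentDomain Ω} ∪ T) := by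
    ext ⟨k, p⟩
    simp only [mem_iUnion, mem_union, mem_image, mem_ofPred_eq, hT, mem_range]
    constructor
    · intro hk
      exact ⟨p, Or.inl ⟨k, hk, rfl⟩⟩
    · rintro ⟨q, ⟨a, ha, hak⟩ | ⟨r, hr⟩⟩
      · rwa [← hak]
      · rw [← hr]; exact one_mem_oneComponentDomain h1 r
  rw [h]
  refine isPreconnected_iUnion ⟨(1, p₀), mem_iInter.2 fun p => Or.inr ⟨p₀, rfl⟩⟩ fun p => ?_
  exact ((isPreconnected_slice_oneComponentDomain Ω p).image _
    (Continuous.prodMk_left p).continuousOn).union (1, p)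
    ⟨1, one_mem_oneComponentDomain h1 p, rfl⟩ ⟨p, rfl⟩ hTc

end

section
variable {𝕜 : Type*} [RCLike 𝕜]
  {E : Type*} [NormedAddCommGroup E] [NormedSpace 𝕜 E]
  {F : Type*} [NormedAddCommGroup F] [NormedSpace 𝕜 F]
  {K : Type*} [TopologicalSpace K] [ChartedSpace E K] [Group K]
  {M : Type*} [TopologicalSpace M] [ChartedSpace F M]
  {Ω : Set (K × M)} {Φ : K × M → M}

theorem IsLocalAction.isOpen_slice (h : IsLocalAction 𝕜 E F Ω Φ) (p : M) :
    IsOpen {k : K | (k, p) ∈ Ω} :=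
  h.isOpen.preimage (Continuous.prodMk_left p)

/-- Components of an open subset of a locally connected space are open and disjoint. So a frontier
point of the component of `1` cannot lie in the old slice, and is a frontier point of that slice
too. -/
theorem IsMaximalLocalAction.restrict_oneComponentDomain [LocallyConnectedSpace K]
    [ConnectedSpace M] (h : IsMaximalLocalAction 𝕜 E F Ω Φ) :
    IsMaximalLocalAction 𝕜 E F (oneComponentDomain Ω) Φ where
  isOpen := isOpen_oneComponentDomain h.isOpen h.one_mem
  isConnected := isConnected_oneComponentDomain h.one_mem
  one_mem := one_mem_oneComponentDomain h.one_mem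
  contMDiffOn := h.contMDiffOn.mono (oneComponentDomain_subset Ω)
  one_act := h.one_act
  mul_act g₁ g₂ p h₁ h₂ h₃ := h.mul_act g₁ g₂ p (oneComponentDomain_subset Ω h₁)
    (oneComponentDomain_subset Ω h₂) (oneComponentDomain_subset Ω h₃)
  leaves_compacts p g g' hg hlim hg' := by
    refine h.leaves_compacts p g g' (fun i => oneComponentDomain_subset Ω (hg i)) hlim ?_
    set V := {k : K | (k, p) ∈ Ω} with hV
    have hVo : IsOpen V := h.isOpen_slice p
    have hV0 : {k : K | (k, p) ∈ oneComponentDomain Ω} = connectedComponentIn V 1 := rfl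
    rw [hV0] at hg'
    have hsub : connectedComponentIn V 1 ⊆ V := connectedComponentIn_subset V 1
    rw [(hVo.connectedComponentIn).frontier_eq] at hg'
    rw [hVo.frontier_eq]
    refine ⟨closure_mono hsub hg'.1, fun hmem => hg'.2 ?_⟩
    obtain ⟨a, ha, ha1⟩ := mem_closure_iff.1 hg'.1 _ (hVo.connectedComponentIn (x := g'))
      (mem_connectedComponentIn hmem)
    rw [connectedComponentIn_eq ha1, ← connectedComponentIn_eq ha]
    exact mem_connectedComponentIn hmem

theorem IsLocalAction.connectedSpace (h : IsLocalAction 𝕜 E F Ω Φ) : ConnectedSpace M := by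
  have h1 : Prod.snd '' Ω = (univ : Set M) :=
    eq_univ_of_forall fun p => ⟨(1, p), h.one_mem p, rfl⟩
  have h2 := h.isConnected.image Prod.snd continuous_snd.continuousOn
  rw [h1] at h2
  exact connectedSpace_iff_univ.2 h2
end

theorem ChartedSpace.firstCountableTopology_of_model (E : Type*) [TopologicalSpace E]
    [FirstCountableTopology E] (K : Type*) [TopologicalSpace K] [ChartedSpace E K] :
    FirstCountableTopology K where
  nhds_generated_countable k := by
    have h := (chartAt E k).symm_map_nhds_eq (mem_chart_source E k)
    rw [← h]
    infer_instance

/-! ### Equivariance of a maximal local action -/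

section
variable {𝕜 : Type*} [RCLike 𝕜]
  {E : Type*} [NormedAddCommGroup E] [NormedSpace 𝕜 E]
  {F : Type*} [NormedAddCommGroup F] [NormedSpace 𝕜 F]
  {K : Type*} [TopologicalSpace K] [ChartedSpace E K] [Group K]
  {M : Type*} [TopologicalSpace M] [ChartedSpace F M]
  {Ω : Set (K × M)} {Φ : K × M → M} {c : K →* K} {σ : M → M}

/-- The derivative at `1` of the orbit map `k ↦ Φ (k, q)`. -/
noncomputable def orbitDeriv (𝕜 : Type*) [RCLike 𝕜]
    (E : Type*) [NormedAddCommGroup E] [NormedSpace 𝕜 E]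
    (F : Type*) [NormedAddCommGroup F] [NormedSpace 𝕜 F]
    {K : Type*} [TopologicalSpace K] [ChartedSpace E K] [Group K]
    {M : Type*} [TopologicalSpace M] [ChartedSpace F M] (Φ : K × M → M) (q : M) : E →L[𝕜] F :=
  (mfderiv 𝓘(𝕜, E) 𝓘(𝕜, F) (fun g : K => Φ (g, q)) 1 : E →L[𝕜] F)

theorem IsLocalAction.mdifferentiableAt (h : IsLocalAction 𝕜 E F Ω Φ) {x : K × M} (hx : x ∈ Ω) :
    MDifferentiableAt (𝓘(𝕜, E).prod 𝓘(𝕜, F)) 𝓘(𝕜, F) Φ x :=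
  (h.contMDiffOn.contMDiffAt (h.isOpen.mem_nhds hx)).mdifferentiableAt (by simp)

theorem IsLocalAction.hasMFDerivAt_orbit (h : IsLocalAction 𝕜 E F Ω Φ) (q : M) :
    HasMFDerivAt 𝓘(𝕜, E) 𝓘(𝕜, F) (fun g : K => Φ (g, q)) 1 (orbitDeriv 𝕜 E F Φ q) :=
  ((h.mdifferentiableAt (h.one_mem q)).comp 1
    (mdifferentiableAt_id.prodMk mdifferentiableAt_const)).hasMFDerivAt

theorem IsLocalAction.tendsto_orbit (h : IsLocalAction 𝕜 E F Ω Φ) {k : K} {q : M}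
    (hk : (k, q) ∈ Ω) : Tendsto (fun k : K => Φ (k, q)) (𝓝 k) (𝓝 (Φ (k, q))) :=
  (h.mdifferentiableAt hk).continuousAt.tendsto.comp ((Continuous.prodMk_left q).tendsto k)

variable [LieGroup 𝓘(𝕜, E) ∞ K]

/-- By `hcσ` the curves `σ (Φ (v, q))` and `Φ (c v, σ q)` agree to first order at `v = 1`. With the
second in place of the first, the function is constant near `1` by the local action law. -/
theorem IsLocalAction.hasMFDerivAt_inv_act (h : IsLocalAction 𝕜 E F Ω Φ)
    (hc : ContMDiff 𝓘(𝕜, E) 𝓘(𝕜, E) ∞ c) (hσ : ContMDiff 𝓘(𝕜, F) 𝓘(𝕜, F) ∞ σ)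
    (hcσ : ∀ (x : E) (q : M),
      (mfderiv 𝓘(𝕜, F) 𝓘(𝕜, F) σ q : F →L[𝕜] F) (orbitDeriv 𝕜 E F Φ q x) =
        orbitDeriv 𝕜 E F Φ (σ q) ((mfderiv 𝓘(𝕜, E) 𝓘(𝕜, E) c 1 : E →L[𝕜] E) x)) (q : M) :
    HasMFDerivAt 𝓘(𝕜, E) 𝓘(𝕜, F) (fun v : K => Φ ((c v)⁻¹, σ (Φ (v, q)))) 1
      (0 : E →L[𝕜] F) := by
  have hα : HasMFDerivAt 𝓘(𝕜, E) 𝓘(𝕜, E) (fun v : K => (c v)⁻¹) 1 _ :=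
    (hc.inv.mdifferentiable (by simp) 1).hasMFDerivAt
  set α' : E →L[𝕜] E := mfderiv 𝓘(𝕜, E) 𝓘(𝕜, E) (fun v : K => (c v)⁻¹) 1
  have hD : HasMFDerivAt (𝓘(𝕜, E).prod 𝓘(𝕜, F)) 𝓘(𝕜, F) Φ (1, σ q) _ :=
    (h.mdifferentiableAt (h.one_mem (σ q))).hasMFDerivAt
  set D : E × F →L[𝕜] F := mfderiv (𝓘(𝕜, E).prod 𝓘(𝕜, F)) 𝓘(𝕜, F) Φ (1, σ q)
  have hσd : HasMFDerivAt 𝓘(𝕜, F) 𝓘(𝕜, F) σ q (mfderiv 𝓘(𝕜, F) 𝓘(𝕜, F) σ q : F →L[𝕜] F) :=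
    (hσ.mdifferentiable (by simp) q).hasMFDerivAt
  have hcd : HasMFDerivAt 𝓘(𝕜, E) 𝓘(𝕜, E) c 1 (mfderiv 𝓘(𝕜, E) 𝓘(𝕜, E) c 1 : E →L[𝕜] E) :=
    (hc.mdifferentiable (by simp) 1).hasMFDerivAt
  have hr := hσd.comp_of_eq_flat (h.hasMFDerivAt_orbit q) (h.one_act q)
  have hr2 := (h.hasMFDerivAt_orbit (σ q)).comp_of_eq_flat hcd (map_one c)
  have heq := ContinuousLinearMap.ext (fun x => hcσ x q) (f :=
    (mfderiv 𝓘(𝕜, F) 𝓘(𝕜, F) σ q : F →L[𝕜] F).comp (orbitDeriv 𝕜 E F Φ q))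
    (g := (orbitDeriv 𝕜 E F Φ (σ q)).comp (mfderiv 𝓘(𝕜, E) 𝓘(𝕜, E) c 1 : E →L[𝕜] E))
  set r' : E →L[𝕜] F := (mfderiv 𝓘(𝕜, F) 𝓘(𝕜, F) σ q : F →L[𝕜] F).comp (orbitDeriv 𝕜 E F Φ q)
  rw [← heq] at hr2
  have hpair : HasMFDerivAt 𝓘(𝕜, E) (𝓘(𝕜, E).prod 𝓘(𝕜, F))
      (fun v : K => ((c v)⁻¹, σ (Φ (v, q)))) 1 (α'.prod r' : E →L[𝕜] E × F) := hα.prodMk hr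
  have hpair2 : HasMFDerivAt 𝓘(𝕜, E) (𝓘(𝕜, E).prod 𝓘(𝕜, F))
      (fun v : K => ((c v)⁻¹, Φ (c v, σ q))) 1 (α'.prod r' : E →L[𝕜] E × F) := hα.prodMk hr2
  have e1 : ((c 1)⁻¹, σ (Φ (1, q))) = ((1 : K), σ q) := by
    rw [map_one, inv_one, h.one_act]
  have e2 : ((c 1)⁻¹, Φ (c 1, σ q)) = ((1 : K), σ q) := by
    rw [map_one, inv_one, h.one_act]
  have hG := hD.comp_of_eq_flat hpair e1
  have hG2 := hD.comp_of_eq_flat hpair2 e2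
  have hconst : (fun v : K => Φ ((c v)⁻¹, Φ (c v, σ q))) =ᶠ[𝓝 1] fun _ => σ q := by
    have t1 : Tendsto (fun v : K => ((c v)⁻¹, Φ (c v, σ q))) (𝓝 1) (𝓝 (1, σ q)) := by
      have := hpair2.continuousAt.tendsto
      rwa [e2] at this
    have t2 : Tendsto (fun v : K => (c v, σ q)) (𝓝 1) (𝓝 (1, σ q)) := by
      have := (hc.continuous.prodMk (continuous_const (y := σ q))).tendsto 1
      rwa [map_one] at this
    filter_upwards [t1.eventually (h.isOpen.mem_nhds (h.one_mem (σ q))),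
      t2.eventually (h.isOpen.mem_nhds (h.one_mem (σ q)))] with v h1 h2
    rw [← h.mul_act _ _ _ (by rw [inv_mul_cancel]; exact h.one_mem _) h2 h1, inv_mul_cancel,
      h.one_act]
  have hzero : HasMFDerivAt 𝓘(𝕜, E) 𝓘(𝕜, F) (fun v : K => Φ ((c v)⁻¹, Φ (c v, σ q))) 1
      (0 : E →L[𝕜] F) :=
    HasMFDerivAt.congr_of_eventuallyEq (hasMFDerivAt_const (σ q) 1) hconst
  have hfin : D.comp (α'.prod r') = 0 := hasMFDerivAt_unique hG2 hzero
  rwa [hfin] at hG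

variable [IsManifold 𝓘(𝕜, F) ∞ M]

/-- For `u` near `1`, `f (v * u)` is `Φ ((c u)⁻¹, ·)` applied to the function of
`IsLocalAction.hasMFDerivAt_inv_act` at the point `Φ (u, q)`. So `f` has zero derivative near `1`
and stays equal to `σ q`; acting by `c u` gives the claim. -/
theorem IsLocalAction.eventually_equivariant (h : IsLocalAction 𝕜 E F Ω Φ)
    (hc : ContMDiff 𝓘(𝕜, E) 𝓘(𝕜, E) ∞ c) (hσ : ContMDiff 𝓘(𝕜, F) 𝓘(𝕜, F) ∞ σ)
    (hcσ : ∀ (x : E) (q : M),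
      (mfderiv 𝓘(𝕜, F) 𝓘(𝕜, F) σ q : F →L[𝕜] F) (orbitDeriv 𝕜 E F Φ q x) =
        orbitDeriv 𝕜 E F Φ (σ q) ((mfderiv 𝓘(𝕜, E) 𝓘(𝕜, E) c 1 : E →L[𝕜] E) x)) (q : M) :
    ∀ᶠ u in 𝓝 (1 : K), Φ (c u, σ q) = σ (Φ (u, q)) := by
  have : IsManifold 𝓘(𝕜, E) ∞ K :=
    (inferInstance : LieGroup 𝓘(𝕜, E) ∞ K).toContMDiffMul.toIsManifold
  have : IsTopologicalGroup K := topologicalGroup_of_lieGroup 𝓘(𝕜, E) ∞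
  have horb : ∀ q, Tendsto (fun v : K => Φ (v, q)) (𝓝 1) (𝓝 q) := fun q => by
    have := (h.hasMFDerivAt_orbit q).continuousAt.tendsto
    rwa [h.one_act] at this
  have hr : ∀ q, Tendsto (fun v : K => σ (Φ (v, q))) (𝓝 1) (𝓝 (σ q)) := fun q =>
    (hσ.continuous.tendsto q).comp (horb q)
  have hci : Tendsto (fun v : K => (c v)⁻¹) (𝓝 1) (𝓝 1) := by
    have := hc.inv.continuous.tendsto 1
    simpa using this
  have hmem : ∀ q, ∀ᶠ v in 𝓝 (1 : K), (v, q) ∈ Ω := fun q =>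
    (h.isOpen_slice q).mem_nhds (h.one_mem q)
  have hmem2 : ∀ q, ∀ᶠ v in 𝓝 (1 : K), ((c v)⁻¹, σ (Φ (v, q))) ∈ Ω := fun q =>
    (hci.prodMk_nhds (hr q)).eventually (h.isOpen.mem_nhds (h.one_mem (σ q)))
  set f : K → M := fun u => Φ ((c u)⁻¹, σ (Φ (u, q))) with hf
  have hf1 : f 1 = σ q := by simp [hf, h.one_act]
  have hfd : ∀ᶠ u in 𝓝 (1 : K), HasMFDerivAt 𝓘(𝕜, E) 𝓘(𝕜, F) f u (0 : E →L[𝕜] F) := by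
    filter_upwards [hmem q, hmem2 q] with u hu hu2
    set p := Φ (u, q) with hp
    have hG := h.hasMFDerivAt_inv_act hc hσ hcσ p
    have hG1 : Φ ((c 1)⁻¹, σ (Φ (1, p))) = σ p := by simp [h.one_act]
    have hB : HasMFDerivAt 𝓘(𝕜, F) 𝓘(𝕜, F) (fun y => Φ ((c u)⁻¹, y)) (σ p)
        (mfderiv 𝓘(𝕜, F) 𝓘(𝕜, F) (fun y => Φ ((c u)⁻¹, y)) (σ p) : F →L[𝕜] F) :=
      ((h.mdifferentiableAt hu2).comp (σ p)
        (mdifferentiableAt_const.prodMk mdifferentiableAt_id)).hasMFDerivAt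
    have h1 := hB.comp_of_eq_flat hG hG1
    have hev : (fun v => f (v * u)) =ᶠ[𝓝 1]
        fun v => Φ ((c u)⁻¹, Φ ((c v)⁻¹, σ (Φ (v, p)))) := by
      have tmul : Tendsto (fun v : K => v * u) (𝓝 1) (𝓝 u) := by
        have := (continuous_mul_const u).tendsto 1
        rwa [one_mul] at this
      have t2 : Tendsto (fun v : K => ((c u)⁻¹ * (c v)⁻¹, σ (Φ (v, p)))) (𝓝 1)
          (𝓝 ((c u)⁻¹, σ p)) := by
        refine Tendsto.prodMk_nhds ?_ (hr p)
        have := hci.const_mul (c u)⁻¹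
        rwa [mul_one] at this
      have t3 : Tendsto (fun v : K => ((c u)⁻¹, Φ ((c v)⁻¹, σ (Φ (v, p))))) (𝓝 1)
          (𝓝 ((c u)⁻¹, σ p)) := by
        refine Tendsto.prodMk_nhds tendsto_const_nhds ?_
        have := hG.continuousAt.tendsto
        rwa [hG1] at this
      filter_upwards [tmul.eventually ((h.isOpen_slice q).mem_nhds hu), hmem p, hmem2 p,
        t2.eventually (h.isOpen.mem_nhds hu2), t3.eventually (h.isOpen.mem_nhds hu2)]
        with v a1 a2 a3 a4 a5
      simp only [hf]
      rw [h.mul_act v u q a1 hu a2, map_mul, mul_inv_rev, h.mul_act _ _ _ a4 a3 a5]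
    have h2 : HasMFDerivAt 𝓘(𝕜, E) 𝓘(𝕜, F) (fun v => f (v * u)) 1 (0 : E →L[𝕜] F) := by
      have := HasMFDerivAt.congr_of_eventuallyEq h1 hev
      have h0 : ∀ B : F →L[𝕜] F, B.comp (0 : E →L[𝕜] F) = 0 := fun B => by simp
      exact HasMFDerivAt.congr_mfderiv this (h0 _)
    have h3 : HasMFDerivAt 𝓘(𝕜, E) 𝓘(𝕜, E) (fun v : K => v * u⁻¹) u _ :=
      ((contMDiff_mul_right (I := 𝓘(𝕜, E)) (n := ∞) (a := u⁻¹)).mdifferentiable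
        (by simp) u).hasMFDerivAt
    have h4 := h2.comp_of_eq_flat h3 (mul_inv_cancel u)
    have h5 : ∀ T : E →L[𝕜] E, (0 : E →L[𝕜] F).comp T = 0 := fun T => by simp
    exact HasMFDerivAt.congr_flat (HasMFDerivAt.congr_mfderiv h4 (h5 _))
      fun v => by rw [inv_mul_cancel_right]
  have hconst := eventually_eq_of_hasMFDerivAt_zero hfd
  have hcσmem : ∀ᶠ v in 𝓝 (1 : K), (c v, σ q) ∈ Ω := by
    have t : Tendsto (fun v : K => c v) (𝓝 1) (𝓝 1) := by
      have := hc.continuous.tendsto 1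
      rwa [map_one] at this
    exact t.eventually (hmem (σ q))
  filter_upwards [hconst, hmem2 q, hcσmem] with u b1 b2 b3
  rw [hf1] at b1
  have b4 := h.mul_act (c u) (c u)⁻¹ (σ (Φ (u, q)))
    (by rw [mul_inv_cancel]; exact h.one_mem _) b2 (by
      have b5 : Φ ((c u)⁻¹, σ (Φ (u, q))) = σ q := b1
      rwa [b5])
  rw [mul_inv_cancel, h.one_act] at b4
  rw [b4]
  exact congrArg (fun y => Φ (c u, y)) b1.symm

/-- The set where equivariance holds locally is open, contains `1` and is closed relative to the
connected slice over `q`. Openness is the local case, translated by `k`; closedness needs maximality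
to know that the limit remains in the domain. -/
theorem IsMaximalLocalAction.equivariant [LocallyCompactSpace M] [T2Space M]
    [FirstCountableTopology K] (h : IsMaximalLocalAction 𝕜 E F Ω Φ)
    (hconn : ∀ p, IsPreconnected {k : K | (k, p) ∈ Ω})
    (hc : ContMDiff 𝓘(𝕜, E) 𝓘(𝕜, E) ∞ c) (hσ : ContMDiff 𝓘(𝕜, F) 𝓘(𝕜, F) ∞ σ)
    (hcσ : ∀ (x : E) (q : M),
      (mfderiv 𝓘(𝕜, F) 𝓘(𝕜, F) σ q : F →L[𝕜] F) (orbitDeriv 𝕜 E F Φ q x) =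
        orbitDeriv 𝕜 E F Φ (σ q) ((mfderiv 𝓘(𝕜, E) 𝓘(𝕜, E) c 1 : E →L[𝕜] E) x))
    {k : K} {q : M} (hk : (k, q) ∈ Ω) :
    (c k, σ q) ∈ Ω ∧ Φ (c k, σ q) = σ (Φ (k, q)) := by
  have : IsTopologicalGroup K := topologicalGroup_of_lieGroup 𝓘(𝕜, E) ∞
  set P : K → Prop := fun k => (c k, σ q) ∈ Ω ∧ Φ (c k, σ q) = σ (Φ (k, q)) with hP
  set u : Set K := {k | ∀ᶠ a in 𝓝 k, P a} with hu
  have huo : IsOpen u := isOpen_iff_mem_nhds.2 fun k hk => eventually_eventually_nhds.2 hk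
  have extend : ∀ k, (k, q) ∈ Ω → P k → k ∈ u := by
    intro k hk ⟨hk1, hk2⟩
    have hev := h.eventually_equivariant hc hσ hcσ (Φ (k, q))
    have t : Tendsto (fun a : K => a * k⁻¹) (𝓝 k) (𝓝 1) := by
      have := (continuous_mul_const k⁻¹).tendsto k
      rwa [mul_inv_cancel] at this
    have tc : Tendsto (fun a : K => c (a * k⁻¹)) (𝓝 k) (𝓝 1) := by
      have := (hc.continuous.tendsto 1).comp t
      rwa [map_one] at this
    filter_upwards [t.eventually hev, (h.isOpen_slice q).mem_nhds hk,
      t.eventually ((h.isOpen_slice (Φ (k, q))).mem_nhds (h.one_mem _)),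
      (hc.continuous.tendsto k).eventually ((h.isOpen_slice (σ q)).mem_nhds hk1),
      tc.eventually ((h.isOpen_slice (σ (Φ (k, q)))).mem_nhds (h.one_mem _))]
      with a a1 a2 a3 a4 a5
    refine ⟨a4, ?_⟩
    have e1 : c a = c (a * k⁻¹) * c k := by rw [← map_mul, inv_mul_cancel_right]
    have e2 : a = a * k⁻¹ * k := by rw [inv_mul_cancel_right]
    have s1 : Φ (c a, σ q) = Φ (c (a * k⁻¹), σ (Φ (k, q))) := by
      rw [← hk2, ← h.mul_act _ _ _ (by rwa [← e1]) hk1 (by rwa [hk2]), ← e1]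
    have s2 : Φ (a, q) = Φ (a * k⁻¹, Φ (k, q)) := by
      rw [← h.mul_act _ _ _ (by rwa [← e2]) hk a3, ← e2]
    rw [s1, s2, a1]
  have hsub : {k : K | (k, q) ∈ Ω} ⊆ u := by
    refine (hconn q).subset_of_closure_inter_subset huo ⟨1, h.one_mem q, ?_⟩ ?_
    · refine extend 1 (h.one_mem q) ⟨?_, ?_⟩
      · rw [map_one]; exact h.one_mem _
      · rw [map_one, h.one_act, h.one_act]
    · rintro a ⟨hac, ha⟩
      obtain ⟨s, hs, hlim⟩ := mem_closure_iff_seq_limit.1 hac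
      have hsP : ∀ n, P (s n) := fun n => (hs n).self_of_nhds
      have ha' : (a, q) ∈ Ω := ha
      have ta : Tendsto (fun n => σ (Φ (s n, q))) atTop (𝓝 (σ (Φ (a, q)))) :=
        (hσ.continuous.tendsto _).comp ((h.tendsto_orbit ha').comp hlim)
      have tc : Tendsto (fun n => c (s n)) atTop (𝓝 (c a)) := (hc.continuous.tendsto a).comp hlim
      have tb : Tendsto (fun n => Φ (c (s n), σ q)) atTop (𝓝 (σ (Φ (a, q)))) :=
        ta.congr fun n => (hsP n).2.symm
      -- Otherwise `c a` would be a frontier point approached by `c (s n)`, while `Φ (c (s n), σ q)`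
      -- converges and so stays in a compact neighbourhood of its limit.
      have hmem : (c a, σ q) ∈ Ω := by
        by_contra hnot
        obtain ⟨C, hC, hCn⟩ := exists_compact_mem_nhds (σ (Φ (a, q)))
        have hfr : c a ∈ frontier {k : K | (k, σ q) ∈ Ω} := by
          rw [(h.isOpen_slice (σ q)).frontier_eq]
          exact ⟨mem_closure_of_tendsto tc (Eventually.of_forall fun n => (hsP n).1), hnot⟩
        have hleave := h.leaves_compacts (σ q) (fun n => c (s n)) (c a) (fun n => (hsP n).1) tc
          hfr C hC
        obtain ⟨n, hn1, hn2⟩ := (hleave.and (tb.eventually hCn)).exists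
        exact hn1 hn2
      refine extend a ha' ⟨hmem, ?_⟩
      have tb' : Tendsto (fun n => Φ (c (s n), σ q)) atTop (𝓝 (Φ (c a, σ q))) :=
        (h.tendsto_orbit hmem).comp tc
      exact tendsto_nhds_unique tb' tb
  have hku : k ∈ u := hsub hk
  exact hku.self_of_nhds

end

/-! ### Decompositions in the semidirect product -/

section
variable {𝕜 : Type*} [RCLike 𝕜]
  {EG : Type*} [NormedAddCommGroup EG] [NormedSpace 𝕜 EG]
  {EH : Type*} [NormedAddCommGroup EH] [NormedSpace 𝕜 EH]
  {EK : Type*} [NormedAddCommGroup EK] [NormedSpace 𝕜 EK]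
  {G : Type*} [TopologicalSpace G] [ChartedSpace EG G] [Group G]
  {H : Type*} [TopologicalSpace H] [ChartedSpace EH H] [Group H]
  {K : Type*} [TopologicalSpace K] [ChartedSpace EK K] [Group K]
  {j : H →* G} {i : K →* G}

/-- Normality keeps the conjugate in the image of `K`, and the first component of `e.symm` recovers
the element of `K` smoothly. -/
theorem IsSemidirectProduct.exists_conj [LieGroup 𝓘(𝕜, EG) ∞ G]
    (hG : IsSemidirectProduct 𝕜 EG EH EK j i) (g : G) :
    ∃ c : K →* K, ContMDiff 𝓘(𝕜, EK) 𝓘(𝕜, EK) ∞ c ∧ ∀ k, i (c k) = g * i k * g⁻¹ := by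
  obtain ⟨e, he⟩ := hG.exists_diffeomorph
  have hi1 : ∀ k, e (k, 1) = i k := fun k => by rw [he, map_one, mul_one]
  have hinj : Function.Injective i := fun a b hab => by
    have := e.injective ((hi1 a).trans (hab.trans (hi1 b).symm))
    exact congrArg Prod.fst this
  have hc : ∀ k, i (e.symm (g * i k * g⁻¹)).1 = g * i k * g⁻¹ := fun k => by
    obtain ⟨k', hk'⟩ := hG.normal.conj_mem (i k) ⟨k, rfl⟩ g
    have : e.symm (i k') = (k', 1) := by rw [← hi1, e.symm_apply_apply]
    rw [← hk', this]
  refine ⟨⟨⟨fun k => (e.symm (g * i k * g⁻¹)).1, hinj ?_⟩, fun a b => hinj ?_⟩, ?_, hc⟩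
  · rw [hc, map_one, mul_one, mul_inv_cancel]
  · simp only
    rw [hc, map_mul i, map_mul i, hc, hc]
    group
  · exact contMDiff_fst.comp (e.symm.contMDiff.comp ((contMDiff_conj g).comp hG.contMDiff_right))

/-- The diffeomorphism has the factor from `K` on the left; applying it to `g⁻¹` puts the factor
from `H` there, so that the global action is applied last. -/
theorem IsSemidirectProduct.exists_decomposition [LieGroup 𝓘(𝕜, EG) ∞ G]
    [LieGroup 𝓘(𝕜, EH) ∞ H] [LieGroup 𝓘(𝕜, EK) ∞ K]
    (hG : IsSemidirectProduct 𝕜 EG EH EK j i) :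
    ∃ (r : G → H) (s : G → K), ContMDiff 𝓘(𝕜, EG) 𝓘(𝕜, EH) ∞ r ∧
      ContMDiff 𝓘(𝕜, EG) 𝓘(𝕜, EK) ∞ s ∧ (∀ g, j (r g) * i (s g) = g) ∧
      ∀ h k, r (j h * i k) = h ∧ s (j h * i k) = k := by
  obtain ⟨e, he⟩ := hG.exists_diffeomorph
  have hs : ContMDiff 𝓘(𝕜, EG) (𝓘(𝕜, EK).prod 𝓘(𝕜, EH)) ∞ fun g : G => e.symm g⁻¹ :=
    e.symm.contMDiff.comp (contMDiff_inv _ _)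
  refine ⟨fun g => (e.symm g⁻¹).2⁻¹, fun g => (e.symm g⁻¹).1⁻¹, (contMDiff_snd.comp hs).inv,
    (contMDiff_fst.comp hs).inv, fun g => ?_, fun h k => ?_⟩
  · change j (e.symm g⁻¹).2⁻¹ * i (e.symm g⁻¹).1⁻¹ = g
    rw [map_inv j, map_inv i, ← mul_inv_rev, ← he, e.apply_symm_apply, inv_inv]
  · have : (j h * i k)⁻¹ = e (k⁻¹, h⁻¹) := by rw [he, mul_inv_rev, map_inv, map_inv]
    simp only
    rw [this, e.symm_apply_apply]
    exact ⟨inv_inv h, inv_inv k⟩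

theorem IsSemidirectProduct.exists_lieAlgMap_add
    (hG : IsSemidirectProduct 𝕜 EG EH EK j i) (X : EG) :
    ∃ (a : EH) (b : EK), (lieAlgMap 𝕜 (E := EH) (E' := EG) j a : EG) +
      (lieAlgMap 𝕜 (E := EK) (E' := EG) i b : EG) = X := by
  obtain ⟨e, he⟩ := hG.exists_diffeomorph
  have he1 : e (1, 1) = 1 := by rw [he, map_one, map_one, mul_one]
  have hes1 : e.symm 1 = (1, 1) := by rw [← he1, e.symm_apply_apply]
  have hD : HasMFDerivAt (𝓘(𝕜, EK).prod 𝓘(𝕜, EH)) 𝓘(𝕜, EG) e (1, 1) _ :=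
    (e.contMDiff.mdifferentiable (by simp) (1, 1)).hasMFDerivAt
  have hS : HasMFDerivAt 𝓘(𝕜, EG) (𝓘(𝕜, EK).prod 𝓘(𝕜, EH)) e.symm 1 _ :=
    (e.symm.contMDiff.mdifferentiable (by simp) 1).hasMFDerivAt
  have hi : HasMFDerivAt 𝓘(𝕜, EK) 𝓘(𝕜, EG) i 1 _ :=
    (hG.contMDiff_right.mdifferentiable (by simp) 1).hasMFDerivAt
  have hj : HasMFDerivAt 𝓘(𝕜, EH) 𝓘(𝕜, EG) j 1 _ :=
    (hG.contMDiff_left.mdifferentiable (by simp) 1).hasMFDerivAt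
  set D : EK × EH →L[𝕜] EG := mfderiv (𝓘(𝕜, EK).prod 𝓘(𝕜, EH)) 𝓘(𝕜, EG) e (1, 1)
  set S : EG →L[𝕜] EK × EH := mfderiv 𝓘(𝕜, EG) (𝓘(𝕜, EK).prod 𝓘(𝕜, EH)) e.symm 1
  set I : EK →L[𝕜] EG := mfderiv 𝓘(𝕜, EK) 𝓘(𝕜, EG) i 1 with hI
  set J : EH →L[𝕜] EG := mfderiv 𝓘(𝕜, EH) 𝓘(𝕜, EG) j 1 with hJ
  have hDS : D.comp S = ContinuousLinearMap.id 𝕜 EG :=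
    hasMFDerivAt_unique ((hD.comp_of_eq_flat hS hes1).congr_flat (g := id)
      fun x => (e.apply_symm_apply x).symm) (hasMFDerivAt_id 1)
  have hinl : HasMFDerivAt 𝓘(𝕜, EK) (𝓘(𝕜, EK).prod 𝓘(𝕜, EH)) (fun k : K => (k, (1 : H))) 1
      (ContinuousLinearMap.inl 𝕜 EK EH) :=
    (hasMFDerivAt_id 1).prodMk (hasMFDerivAt_const 1 1)
  have hinr : HasMFDerivAt 𝓘(𝕜, EH) (𝓘(𝕜, EK).prod 𝓘(𝕜, EH)) (fun h : H => ((1 : K), h)) 1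
      (ContinuousLinearMap.inr 𝕜 EK EH) :=
    (hasMFDerivAt_const 1 1).prodMk (hasMFDerivAt_id 1)
  have hDI : I = D.comp (ContinuousLinearMap.inl 𝕜 EK EH) :=
    hasMFDerivAt_unique hi ((hD.comp_of_eq_flat hinl rfl).congr_flat fun k => by
      rw [he, map_one, mul_one])
  have hDJ : J = D.comp (ContinuousLinearMap.inr 𝕜 EK EH) :=
    hasMFDerivAt_unique hj ((hD.comp_of_eq_flat hinr rfl).congr_flat fun k => by
      rw [he, map_one, one_mul])
  refine ⟨(S X).2, (S X).1, ?_⟩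
  change J (S X).2 + I (S X).1 = X
  have h1 : D (S X) = X := congrArg (fun T : EG →L[𝕜] EG => T X) hDS
  rw [hDI, hDJ]
  conv_rhs => rw [← h1]
  simp only [ContinuousLinearMap.comp_apply, ContinuousLinearMap.inl_apply,
    ContinuousLinearMap.inr_apply]
  rw [← map_add]
  simp

end

/-! ### The local action of `G` -/

theorem theoremB
    {𝕜 : Type*} [RCLike 𝕜]
    {EG : Type*} [NormedAddCommGroup EG] [NormedSpace 𝕜 EG] [FiniteDimensional 𝕜 EG]
    {EH : Type*} [NormedAddCommGroup EH] [NormedSpace 𝕜 EH] [FiniteDimensional 𝕜 EH]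
    {EK : Type*} [NormedAddCommGroup EK] [NormedSpace 𝕜 EK] [FiniteDimensional 𝕜 EK]
    {F : Type*} [NormedAddCommGroup F] [NormedSpace 𝕜 F] [FiniteDimensional 𝕜 F]
    {G : Type*} [TopologicalSpace G] [ChartedSpace EG G] [Group G] [LieGroup 𝓘(𝕜, EG) ∞ G]
    [ConnectedSpace G]
    {H : Type*} [TopologicalSpace H] [ChartedSpace EH H] [Group H] [LieGroup 𝓘(𝕜, EH) ∞ H]
    [ConnectedSpace H]
    {K : Type*} [TopologicalSpace K] [ChartedSpace EK K] [Group K] [LieGroup 𝓘(𝕜, EK) ∞ K]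
    [ConnectedSpace K]
    {M : Type*} [TopologicalSpace M] [T2Space M] [ChartedSpace F M] [IsManifold 𝓘(𝕜, F) ∞ M]
    (j : H →* G) (i : K →* G) (hG : IsSemidirectProduct 𝕜 EG EH EK j i)
    (ρ : LieAlg 𝕜 EG G →ₗ[𝕜] SmoothVectorField 𝕜 F M)
    (hρ : IsVectorFieldRepresentation ρ)
    (hH : IntegratesToGlobalAction (ρ ∘ₗ lieAlgMap 𝕜 (E := EH) (E' := EG) j))
    (hK : IsUnivalent (ρ ∘ₗ lieAlgMap 𝕜 (E := EK) (E' := EG) i)) :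
    IsUnivalent ρ := by
  obtain ⟨Ψ, hΨ, hΨi⟩ := hH
  obtain ⟨Ω', Φ, hΦ', hΦi⟩ := hK
  have : ProperSpace F := FiniteDimensional.proper 𝕜 F
  have : LocallyCompactSpace M := ChartedSpace.locallyCompactSpace F M
  have : FirstCountableTopology K := ChartedSpace.firstCountableTopology_of_model EK K
  let : NormedSpace ℝ EK := .restrictScalars ℝ 𝕜 EK
  have : LocallyConnectedSpace K := ChartedSpace.locallyConnectedSpace EK K
  have : ConnectedSpace M := hΨ.connectedSpace
  set Ω : Set (K × M) := oneComponentDomain Ω'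
  have hΦ : IsMaximalLocalAction 𝕜 EK F Ω Φ := hΦ'.restrict_oneComponentDomain
  have hΨs : ContMDiff (𝓘(𝕜, EH).prod 𝓘(𝕜, F)) 𝓘(𝕜, F) ∞ Ψ := contMDiffOn_univ.1 hΨ.contMDiffOn
  have hm : ∀ u v p, Ψ (u * v, p) = Ψ (u, Ψ (v, p)) := fun u v p =>
    hΨ.mul_act u v p (mem_univ _) (mem_univ _) (mem_univ _)
  have hΨh : ∀ h : H, ContMDiff 𝓘(𝕜, F) 𝓘(𝕜, F) ∞ fun p => Ψ (h, p) := fun h =>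
    hΨs.comp (contMDiff_const.prodMk contMDiff_id)
  have equiv : ∀ (h : H) (c : K →* K), ContMDiff 𝓘(𝕜, EK) 𝓘(𝕜, EK) ∞ c →
      (∀ k, i (c k) = j h * i k * (j h)⁻¹) → ∀ k q, (k, q) ∈ Ω →
      (c k, Ψ (h, q)) ∈ Ω ∧ Φ (c k, Ψ (h, q)) = Ψ (h, Φ (k, q)) := by
    intro h c hc hci k q hkq
    refine hΦ.equivariant (σ := fun p => Ψ (h, p))
      (isPreconnected_slice_oneComponentDomain Ω') hc (hΨh h) (fun x q => ?_) hkq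
    have hid : HasMFDerivAt 𝓘(𝕜, EK) 𝓘(𝕜, EG) i 1
        (mfderiv 𝓘(𝕜, EK) 𝓘(𝕜, EG) i 1 : EK →L[𝕜] EG) :=
      (hG.contMDiff_right.mdifferentiable (by simp) 1).hasMFDerivAt
    have hcd : HasMFDerivAt 𝓘(𝕜, EK) 𝓘(𝕜, EK) c 1
        (mfderiv 𝓘(𝕜, EK) 𝓘(𝕜, EK) c 1 : EK →L[𝕜] EK) :=
      (hc.mdifferentiable (by simp) 1).hasMFDerivAt
    have hcomp := hasMFDerivAt_unique (hid.comp_of_eq_flat hcd (map_one c))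
      (((hasMFDerivAt_conj (𝕜 := 𝕜) (EG := EG) (j h)).comp_of_eq_flat hid (map_one i)).congr_flat
        hci)
    set x' : EK := (mfderiv 𝓘(𝕜, EK) 𝓘(𝕜, EK) c 1 : EK →L[𝕜] EK) x
    have hx : (lieAlgMap 𝕜 (E := EK) (E' := EG) i x' : EG) =
        adjointMap 𝕜 (EG := EG) (j h) (lieAlgMap 𝕜 (E := EK) (E' := EG) i x) :=
      congrArg (fun T : EK →L[𝕜] EG => T x) hcomp
    have h1 := hΦi.mfderiv_apply x q
    have h2 := hΦi.mfderiv_apply x' (Ψ (h, q))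
    have h3 := mfderiv_act_apply_eq_adjointMap hG.contMDiff_left hρ hΨs hΨ.one_act hm hΨi
      (lieAlgMap 𝕜 (E := EK) (E' := EG) i x) q h
    have h4 : actDeriv 𝕜 F Ψ h q (orbitDeriv 𝕜 EK F Φ q x) =
        -actDeriv 𝕜 F Ψ h q (ρ (lieAlgMap 𝕜 (E := EK) (E' := EG) i x) q) :=
      (congrArg (actDeriv 𝕜 F Ψ h q) h1).trans (map_neg _ _)
    refine h4.trans (Eq.trans ?_ h2.symm)
    refine congrArg (fun w : F => -w) (h3.trans ?_)
    exact congrArg (fun Y : LieAlg 𝕜 EG G => (ρ Y (Ψ (h, q)) : F)) hx.symm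
  obtain ⟨r, s, hr, hs, hrs, hrs'⟩ := hG.exists_decomposition
  have hr1 : ∀ h, r (j h) = h ∧ s (j h) = 1 := fun h => by simpa using hrs' h 1
  have hs1 : ∀ k, r (i k) = 1 ∧ s (i k) = k := fun k => by simpa using hrs' 1 k
  have hone : r 1 = 1 ∧ s 1 = 1 := by simpa using hrs' 1 1
  set ΩG : Set (G × M) := {x | (s x.1, x.2) ∈ Ω} with hΩG
  set ΦG : G × M → M := fun x => Ψ (r x.1, Φ (s x.1, x.2)) with hΦG
  have hsc : Continuous fun x : G × M => (s x.1, x.2) :=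
    (hs.continuous.comp continuous_fst).prodMk continuous_snd
  have hloc : IsLocalAction 𝕜 EG F ΩG ΦG := by
    refine ⟨hΦ.isOpen.preimage hsc, ?_, ?_, ?_, ?_, ?_⟩
    · have himg : ΩG = (fun y : H × (K × M) => (j y.1 * i y.2.1, y.2.2)) '' (univ ×ˢ Ω) := by
        ext ⟨g, p⟩
        constructor
        · intro hg
          exact ⟨(r g, (s g, p)), ⟨mem_univ _, hg⟩, by simp only [hrs]⟩
        · rintro ⟨⟨h, k, q⟩, ⟨-, hkq⟩, heq⟩
          rw [← heq]
          change (s (j h * i k), q) ∈ Ω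
          rwa [(hrs' h k).2]
      rw [himg]
      refine (isConnected_univ.prod hΦ.isConnected).image _ (Continuous.continuousOn ?_)
      have : ContinuousMul G := (topologicalGroup_of_lieGroup 𝓘(𝕜, EG) ∞).toContinuousMul
      exact ((hG.contMDiff_left.continuous.comp continuous_fst).mul
        (hG.contMDiff_right.continuous.comp (continuous_fst.comp continuous_snd))).prodMk
        (continuous_snd.comp continuous_snd)
    · intro p
      change (s 1, p) ∈ Ω
      rw [hone.2]
      exact hΦ.one_mem p
    · have h1 : ContMDiffOn (𝓘(𝕜, EG).prod 𝓘(𝕜, F)) 𝓘(𝕜, F) ∞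
          (fun x : G × M => Φ (s x.1, x.2)) ΩG :=
        hΦ.contMDiffOn.comp ((hs.comp contMDiff_fst).prodMk contMDiff_snd).contMDiffOn
          fun x hx => hx
      exact hΨs.comp_contMDiffOn ((hr.comp contMDiff_fst).contMDiffOn.prodMk h1)
    · intro p
      change Ψ (r 1, Φ (s 1, p)) = p
      rw [hone.1, hone.2, hΦ.one_act, hΨ.one_act]
    · intro g₁ g₂ p h12 h2 h1
      change (s (g₁ * g₂), p) ∈ Ω at h12
      change (s g₂, p) ∈ Ω at h2
      change (s g₁, Ψ (r g₂, Φ (s g₂, p))) ∈ Ω at h1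
      -- In `h₁ k₁ h₂ k₂ = (h₁ h₂) (h₂⁻¹ k₁ h₂) k₂`, the element `k₁` is moved past `h₂` by
      -- conjugation with `h₂⁻¹`.
      obtain ⟨c, hc, hci⟩ := hG.exists_conj (j (r g₂)⁻¹)
      have hdec : g₁ * g₂ = j (r g₁ * r g₂) * i (c (s g₁) * s g₂) := by
        conv_lhs => rw [← hrs g₁, ← hrs g₂]
        rw [map_mul, map_mul, hci, map_inv]
        group
      have hr12 : r (g₁ * g₂) = r g₁ * r g₂ := by rw [hdec]; exact (hrs' _ _).1
      have hs12 : s (g₁ * g₂) = c (s g₁) * s g₂ := by rw [hdec]; exact (hrs' _ _).2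
      -- Equivariance under `h₂⁻¹` also supplies the membership in `Ω` that the composition law of
      -- `Φ` requires.
      obtain ⟨e1, e2⟩ := equiv (r g₂)⁻¹ c hc hci _ _ h1
      rw [← hm, inv_mul_cancel, hΨ.one_act] at e1 e2
      change Ψ (r (g₁ * g₂), Φ (s (g₁ * g₂), p)) = Ψ (r g₁, Φ (s g₁, Ψ (r g₂, Φ (s g₂, p))))
      rw [hs12] at h12
      rw [hr12, hs12, hΦ.mul_act _ _ _ h12 h2 e1, e2, ← hm, mul_inv_cancel_right]
  refine ⟨ΩG, ΦG, ⟨hloc, ?_⟩, ?_⟩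
  · intro p g g' hg hlim hg' C hC
    have hfr : s g' ∈ frontier {k : K | (k, p) ∈ Ω} :=
      hs.continuous.frontier_preimage_subset {k : K | (k, p) ∈ Ω} hg'
    have : ContinuousInv H := (topologicalGroup_of_lieGroup 𝓘(𝕜, EH) ∞).toContinuousInv
    have hlr : Tendsto (fun n => (r (g n))⁻¹) atTop (𝓝 (r g')⁻¹) :=
      ((hr.continuous.tendsto g').comp hlim).inv
    -- The elements `(r (g n))⁻¹` and their limit form a compact set. If `ΦG (g n, p)` were in `C`,
    -- then undoing the action of `H` would put `Φ (s (g n), p)` in this compact set, against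
    -- maximality of `Φ`.
    have hC' : IsCompact (Ψ '' (insert (r g')⁻¹ (range fun n => (r (g n))⁻¹) ×ˢ C)) :=
      (hlr.isCompact_insert_range.prod hC).image hΨs.continuous
    filter_upwards [hΦ.leaves_compacts p (fun n => s (g n)) (s g') hg
      ((hs.continuous.tendsto g').comp hlim) hfr _ hC'] with n hn hnC
    refine hn ⟨((r (g n))⁻¹, ΦG (g n, p)), ⟨mem_insert_of_mem _ ⟨n, rfl⟩, hnC⟩, ?_⟩
    change Ψ ((r (g n))⁻¹, Ψ (r (g n), Φ (s (g n), p))) = Φ (s (g n), p)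
    rw [← hm, inv_mul_cancel, hΨ.one_act]
  -- Both sides are linear in `X`, and `ΦG` restricts to `Ψ` on `H` and to `Φ` on `K`, whose Lie
  -- algebras span that of `G`.
  · intro X p
    have hT := hloc.hasMFDerivAt_orbit p
    have hid : HasMFDerivAt 𝓘(𝕜, EK) 𝓘(𝕜, EG) i 1
        (mfderiv 𝓘(𝕜, EK) 𝓘(𝕜, EG) i 1 : EK →L[𝕜] EG) :=
      (hG.contMDiff_right.mdifferentiable (by simp) 1).hasMFDerivAt
    have hjd : HasMFDerivAt 𝓘(𝕜, EH) 𝓘(𝕜, EG) j 1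
        (mfderiv 𝓘(𝕜, EH) 𝓘(𝕜, EG) j 1 : EH →L[𝕜] EG) :=
      (hG.contMDiff_left.mdifferentiable (by simp) 1).hasMFDerivAt
    have hTi := hasMFDerivAt_unique ((hT.comp_of_eq_flat hid (map_one i)).congr_flat
      (g := fun k => Φ (k, p)) fun k => by
        simp only [hΦG]
        rw [(hs1 k).1, (hs1 k).2, hΨ.one_act]) (hΦ.hasMFDerivAt_orbit p)
    have hTj := hasMFDerivAt_unique ((hT.comp_of_eq_flat hjd (map_one j)).congr_flat
      (g := fun h => Ψ (h, p)) fun h => by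
        simp only [hΦG]
        rw [(hr1 h).1, (hr1 h).2, hΦ.one_act]) (hΨ.hasMFDerivAt_orbit p)
    obtain ⟨a, b, hab⟩ := hG.exists_lieAlgMap_add X
    set A : LieAlg 𝕜 EG G := lieAlgMap 𝕜 (E := EH) (E' := EG) j a
    set B : LieAlg 𝕜 EG G := lieAlgMap 𝕜 (E := EK) (E' := EG) i b
    have hA : orbitDeriv 𝕜 EG F ΦG p A = -(ρ A p : F) :=
      (congrArg (fun T : EH →L[𝕜] F => T a) hTj).trans (hΨi.mfderiv_apply a p)
    have hB : orbitDeriv 𝕜 EG F ΦG p B = -(ρ B p : F) :=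
      (congrArg (fun T : EK →L[𝕜] F => T b) hTi).trans (hΦi.mfderiv_apply b p)
    have hρX : (ρ X p : F) = (ρ A p : F) + (ρ B p : F) := by
      have h1 : A + B = X := hab
      have h2 : ρ X = ρ A + ρ B := by rw [← h1, map_add]
      rw [h2]
      rfl
    have hlin : ∀ (T : EG →L[𝕜] F) (A B X : EG) (a b : F), A + B = X → T A = -a → T B = -b →
        a + b = T (-X) := by
      rintro T A B _ a b rfl ha hb
      rw [map_neg, map_add, ha, hb]
      abel
    exact hρX.trans (hlin _ A B X _ _ hab hA hB)
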